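/- Let $K$ be a field, $E$ a directed graph (of arbitrary cardinality) with vertex set $E^0$, edge set $E^1$, source map $\mathbf s$ and range map $\mathbf r$, and let $L_K(E)$ be its Leavitt path algebra with the natural $\mathbb Z$-grading ($pq^*$ has degree $|p|-|q|$). A graded simple $L_K(E)$-module is a $\mathbb Z$-graded left module $M$ with $L_K(E)M\neq 0$ whose only graded submodules are $0$ and $M$. Write $u\ge v$ if there is a path (possibly of length $0$) from $u$ to $v$, $R(V)=\{u : u\ge v\text{ for some }v\in V\}$ and $R(v)=R(\{v\})$. For an infinite path $\alpha$, $\alpha^0$ is its set of vertices; $\alpha$ is irrational if it is not tail equivalent to $ccc\ldots$ for a closed path $c$ of positive length; $\alpha$ is strictly decreasing if $\alpha=p_1p_2\ldots$ for finite paths $p_n$ with $\mathbf s(p_n)\ge\mathbf s(p_{n+1})\not\ge\mathbf s(p_n)$ for all $n$. A cycle is a closed path of positive length whose edges have pairwise different sources; $c^0$ is its set of vertices, and cycles which differ only by the choice of the base vertex are identified. A cycle $c$ is exclusive if no vertex of $c$ is the base of a cycle distinct from $c$. For $V\subseteq E^0$, a cycle $c$ is extreme in $V$ if $c^0\subseteq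 V$, some edge $e$ not in $c$ has $\mathbf s(e)\in c^0$ and $\mathbf r(e)\in V$, and for every path $p$ with vertices in $V$ and $\mathbf s(p)\in c^0$ there is a path $q$ with vertices in $V$ such that $\mathbf s(q)=\mathbf r(p)$ and $\mathbf r(q)\in c^0$. For a vertex $v$, put $\rho(v)=\{e\in E^1 : \mathbf s(e)=v,\ \mathbf r(e)\in R(v)\}$ (the return edges of $v$). Consider the following modules. Each is a $K$-vector space with a basis $X$, and $L_K(E)$ acts as follows: a vertex $w$ fixes the basis elements with source $w$ and annihilates the others, an edge $e$ maps each basis element $x$ with source $\mathbf r(e)$ to $ex$ and annihilates the others, and $e^*$ inverts the action of $e$ on the image of $e$ in $X$ and annihilates the remaining basis elements. - $\mathbf V_{[\alpha]}$, for an infinite path $\alpha$: $X$ is the set of infinite paths tail equivalent to $\alpha$. - $\mathbf N_v$, for a sink or an infinite emitter $v$: $X$ is the set of finite paths ending at $v$. - $\mathbf N_c=\mathbf N_c^v$, for an exclusive cycle $c$ and $v\in c^0$: $X$ is the set of formal expressions $pq^*$ (with source $\mathbf s(p)$) where $p,q$ are paths with $\mathbf r(p)=\mathbf r(q)\in c^0$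 and $\mathbf s(q)=v$ which do not both have positive length and end with the same edge; $e\cdot pq^*$ is the expression obtained from $epq^*$ by cancelling common last edges of $ep$ and $q$. **Theorem.** If $M$ is a graded simple $L_K(E)$-module, then $\operatorname{ann}(M)$ is the annihilator of a module in exactly one of the following four classes. 1. (Strictly-decreasing-infinite-path type) $\mathbf V_{[\alpha]}$, where $\alpha$ is a strictly decreasing infinite path such that $R(v)\subsetneq R(\alpha^0)$ for all $v\in R(\alpha^0)$. 2. (Relative-sink types) $\mathbf N_v$, where $v$ is a sink, or $\mathbf N_v$ ($=\mathbf N_{v\emptyset}$), where $v$ is an infinite emitter with $\rho(v)=\emptyset$. 3. (Extreme-cycle types) $\mathbf V_{[\alpha]}$, where $\alpha$ is an irrational infinite path each vertex of which lies on a cycle extreme in $R(\alpha^0)$; or $\mathbf N_v$ ($=\mathbf N_{v\infty}$), where $v$ is an infinite emitter with $\rho(v)$ infinite; or $\mathbf N_v$ ($=\mathbf N_{v\in B_H}$), where $v$ is an infinite emitter with $\rho(v)$ finite and $|\rho(v)|>1$. 4. (Exclusive-cycle types) $\mathbf N_c$, where $c$ is an exclusive cycle; or $\mathbf N_v$ ($=\mathbf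 N_{v\in B_H}$), where $v$ is an infinite emitter with $|\rho(v)|=1$. -/

import Mathlib

/-- A directed graph with vertex set `V` and edge set `A` (loops, multiple edges and infinite
emitters are allowed, and there is no cardinality restriction). -/
structure DirGraph (V : Type*) (A : Type*) where
  /-- the source map -/
  src : A → V
  /-- the range map -/
  rng : A → V

namespace DirGraph

variable {V A : Type*} (E : DirGraph V A)

/-! ### Vertices, paths, cycles -/

/-- The set of edges emitted by `v`. -/
def out (v : V) : Set A := {e | E.src e = v}

/-- `v` emits no edges. -/
def IsSink (v : V) : Prop := E.out v = ∅

/-- `v` emits infinitely many edges. -/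
def IsInfiniteEmitter (v : V) : Prop := (E.out v).Infinite

/-- `v` is neither a sink nor an infinite emitter. -/
def IsRegular (v : V) : Prop := ¬ E.IsSink v ∧ ¬ E.IsInfiniteEmitter v

/-- `E.IsPath u l v`: the list of edges `l` is a path from `u` to `v`; the empty list is the
path of length zero at a vertex. -/
def IsPath : V → List A → V → Prop
  | u, [], v => u = v
  | u, e :: l, v => E.src e = u ∧ IsPath (E.rng e) l v

/-- The vertices on the path with source `u` and edge list `l`. -/
def pathVerts (u : V) (l : List A) : Set V := {w | w = u ∨ ∃ e ∈ l, E.rng e = w}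

/-- `u ≥ v`: there is a path from `u` to `v`. -/
def Reaches (u v : V) : Prop := ∃ l, E.IsPath u l v

/-- The root `R(S)` of a set of vertices. -/
def root (S : Set V) : Set V := {u | ∃ v ∈ S, E.Reaches u v}

/-- `c` is a cycle based at `v`: a closed path of positive length whose edges have pairwise
different sources. -/
def IsCycleAt (v : V) (c : List A) : Prop :=
  c ≠ [] ∧ E.IsPath v c v ∧ (c.map E.src).Nodup

/-- The vertices of a closed path of positive length with edge list `c`. -/
def cycVerts (c : List A) : Set V := {w | ∃ e ∈ c, E.src e = w}

/-- `c` is an exclusive cycle: no vertex on `c` is the base of a cycle distinct from `c`. A cycle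
may be based at any of its vertices, so cycles are compared up to rotation of the edge list. -/
def IsExclusive (c : List A) : Prop :=
  (∃ v, E.IsCycleAt v c) ∧ ∀ w ∈ E.cycVerts c, ∀ d, E.IsCycleAt w d → d ~r c

/-- `c` is a cycle which is extreme in the set of vertices `S`. -/
def IsExtremeIn (c : List A) (S : Set V) : Prop :=
  (∃ v, E.IsCycleAt v c) ∧ E.cycVerts c ⊆ S ∧
  (∃ e, E.src e ∈ E.cycVerts c ∧ e ∉ c ∧ E.rng e ∈ S) ∧
  ∀ u p w, u ∈ E.cycVerts c → E.IsPath u p w → E.pathVerts u p ⊆ S →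
    ∃ q x, E.IsPath w q x ∧ E.pathVerts w q ⊆ S ∧ x ∈ E.cycVerts c

/-- The edges from `v` to `R(v)`. -/
def returnEdges (v : V) : Set A := {e | E.src e = v ∧ E.rng e ∈ E.root {v}}

/-! ### Infinite paths -/

/-- `α 0, α 1, …` is an infinite path. -/
def IsInfPath (α : ℕ → A) : Prop := ∀ n, E.rng (α n) = E.src (α (n + 1))

/-- The vertices of an infinite path. -/
def infVerts (α : ℕ → A) : Set V := Set.range fun n => E.src (α n)

/-- Two infinite paths which are equal after removing a finite prefix from each of them. -/
def TailEquiv (α β : ℕ → A) : Prop := ∃ m n, ∀ k, α (m + k) = β (n + k)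

/-- `α` is tail equivalent to `ccc…` for a closed path `c` of positive length. -/
def IsRational (α : ℕ → A) : Prop :=
  ∃ (v : V) (c : List A) (hc : c ≠ []), E.IsPath v c v ∧
    TailEquiv α fun n => c.get ⟨n % c.length, Nat.mod_lt n (List.length_pos_iff.2 hc)⟩

/-- `α` is a concatenation `p₀p₁p₂…` of finite paths such that
`s(p₀) > s(p₁) > s(p₂) > …`, where `u > v` means `u ≥ v` and not `v ≥ u`. Here `pₖ` consists of
the edges of `α` with the indices from `t k` to `t (k + 1) - 1`. -/
def IsStrictlyDecreasing (α : ℕ → A) : Prop :=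
  E.IsInfPath α ∧ ∃ t : ℕ → ℕ, t 0 = 0 ∧ StrictMono t ∧
    ∀ k, E.Reaches (E.src (α (t k))) (E.src (α (t (k + 1)))) ∧
      ¬ E.Reaches (E.src (α (t (k + 1)))) (E.src (α (t k)))

/-! ### The Leavitt path algebra -/

/-- The generators: the vertices, the edges `e` and the ghost edges `e*`. -/
inductive Gen (V A : Type*)
  | vtx (v : V)
  | edge (e : A)
  | ghost (e : A)

variable (K : Type*) [Field K]

open FreeAlgebra in
/-- The defining relations (V), (E) (for the edges and the ghost edges), (CK1), (CK2). -/
inductive Rel : FreeAlgebra K (Gen V A) → FreeAlgebra K (Gen V A) → Prop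
  | vv (v : V) : Rel (ι K (.vtx v) * ι K (.vtx v)) (ι K (.vtx v))
  | vw (v w : V) (h : v ≠ w) : Rel (ι K (.vtx v) * ι K (.vtx w)) 0
  | src_edge (e : A) : Rel (ι K (.vtx (E.src e)) * ι K (.edge e)) (ι K (.edge e))
  | edge_rng (e : A) : Rel (ι K (.edge e) * ι K (.vtx (E.rng e))) (ι K (.edge e))
  | rng_ghost (e : A) : Rel (ι K (.vtx (E.rng e)) * ι K (.ghost e)) (ι K (.ghost e))
  | ghost_src (e : A) : Rel (ι K (.ghost e) * ι K (.vtx (E.src e))) (ι K (.ghost e))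
  | ghost_edge (e : A) : Rel (ι K (.ghost e) * ι K (.edge e)) (ι K (.vtx (E.rng e)))
  | ghost_edge_ne (e f : A) (h : e ≠ f) : Rel (ι K (.ghost e) * ι K (.edge f)) 0
  | ck2 (v : V) (hfin : (E.out v).Finite) (hne : (E.out v).Nonempty) :
      Rel (ι K (.vtx v)) (∑ e ∈ hfin.toFinset, ι K (.edge e) * ι K (.ghost e))

/-- The *unital* `K`-algebra given by the generators and relations above. As none of the
relations involves `1`, it is the unitization of the (in general non-unital) `K`-algebra given by
the same generators and relations. -/
abbrev UnitalLPA : Type _ := RingQuot (E.Rel K)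

/-- The image of a generator. -/
noncomputable def gen (g : Gen V A) : E.UnitalLPA K :=
  RingQuot.mkAlgHom K (E.Rel K) (FreeAlgebra.ι K g)

/-- The Leavitt path algebra `L_K(E)`, a non-unital `K`-algebra: the `K`-linear span of the
nonempty products of generators. -/
abbrev LPA : Type _ := NonUnitalAlgebra.adjoin K (Set.range (E.gen K))

/-- The generators as elements of `L_K(E)`. -/
noncomputable def lgen (g : Gen V A) : E.LPA K :=
  ⟨E.gen K g, NonUnitalAlgebra.subset_adjoin K ⟨g, rfl⟩⟩

/-- The element of `L_K(E)` given by the path with source `u` and edge list `l`. -/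
noncomputable def pathElt : V → List A → E.LPA K
  | u, [] => E.lgen K (.vtx u)
  | _, e :: l => E.lgen K (.edge e) * pathElt (E.rng e) l

/-- The element `p*` of `L_K(E)` for the path `p` with source `u` and edge list `l`. -/
noncomputable def ghostElt : V → List A → E.LPA K
  | u, [] => E.lgen K (.vtx u)
  | _, e :: l => ghostElt (E.rng e) l * E.lgen K (.ghost e)

/-- The `n`-th component of the natural `ℤ`-grading of `L_K(E)`: the `K`-linear span of the
elements `pq*` with `|p| - |q| = n`. -/
def gr (n : ℤ) : Submodule K (E.LPA K) :=
  Submodule.span K {x | ∃ u p v q w, E.IsPath u p w ∧ E.IsPath v q w ∧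
    (p.length : ℤ) - q.length = n ∧ x = E.pathElt K u p * E.ghostElt K v q}

/-! ### Modules

A left module over the non-unital ring `L_K(E)` is an abelian group `M` with a homomorphism of
non-unital rings `ρ : L_K(E) → End(M)`. -/

variable {K E}

/-- The annihilator of a module. -/
def ann {M : Type*} [AddCommGroup M] (ρ : E.LPA K →ₙ+* AddMonoid.End M) : Set (E.LPA K) :=
  {a | ∀ m, ρ a m = 0}

/-- The module `M`, with the decomposition `M = ⨁ ℳ n`, is a graded simple `L_K(E)`-module:
it is graded, `L_K(E) · M ≠ 0` (so, in particular, `M ≠ 0`), and the only graded submodules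
are `0` and `M`. -/
structure IsGradedSimple {M : Type*} [AddCommGroup M] (ρ : E.LPA K →ₙ+* AddMonoid.End M)
    (ℳ : ℤ → AddSubgroup M) [DirectSum.Decomposition ℳ] : Prop where
  graded : ∀ i j, ∀ a ∈ E.gr K i, ∀ m ∈ ℳ j, ρ a m ∈ ℳ (i + j)
  nontrivial : ∃ a m, ρ a m ≠ 0
  simple : ∀ N : AddSubgroup M, (∀ a, ∀ m ∈ N, ρ a m ∈ N) →
    (∀ m ∈ N, ∀ i, (DirectSum.decompose ℳ m i : M) ∈ N) → N = ⊥ ∨ N = ⊤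

/-! ### Branching systems -/

variable (E)

/-- A branching system of `E` on the set `X`. -/
structure Branching (X : Type*) where
  /-- the sets `X_v` -/
  vset : V → Set X
  /-- the sets `X_e` -/
  eset : A → Set X
  /-- the bijections `σ_e : X_{r(e)} → X_e` -/
  σ : ∀ e, vset (E.rng e) ≃ eset e
  vset_disjoint : ∀ v w, v ≠ w → Disjoint (vset v) (vset w)
  eset_disjoint : ∀ e f, e ≠ f → Disjoint (eset e) (eset f)
  eset_subset : ∀ e, eset e ⊆ vset (E.src e)
  vset_eq : ∀ v, E.IsRegular v → vset v = ⋃ e ∈ E.out v, eset e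

namespace Branching

variable {E} {X : Type*} (B : E.Branching X) (K)

open Classical in
/-- The action of the generators on the vector space with basis `X`. -/
noncomputable def act : Gen V A → Module.End K (X →₀ K)
  | .vtx v => Finsupp.linearCombination K fun x =>
      if x ∈ B.vset v then Finsupp.single x 1 else 0
  | .edge e => Finsupp.linearCombination K fun x =>
      if h : x ∈ B.vset (E.rng e) then Finsupp.single (B.σ e ⟨x, h⟩ : X) 1 else 0
  | .ghost e => Finsupp.linearCombination K fun x =>
      if h : x ∈ B.eset e then Finsupp.single ((B.σ e).symm ⟨x, h⟩ : X) 1 else 0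

theorem act_vtx_mem {v : V} {x : X} (h : x ∈ B.vset v) :
    B.act K (.vtx v) (Finsupp.single x 1) = Finsupp.single x 1 := by
  simp [act, h]

theorem act_vtx_notMem {v : V} {x : X} (h : x ∉ B.vset v) :
    B.act K (.vtx v) (Finsupp.single x 1) = 0 := by
  simp [act, h]

theorem act_edge_mem {e : A} {x : X} (h : x ∈ B.vset (E.rng e)) :
    B.act K (.edge e) (Finsupp.single x 1) = Finsupp.single (B.σ e ⟨x, h⟩ : X) 1 := by
  simp [act, h]

theorem act_edge_notMem {e : A} {x : X} (h : x ∉ B.vset (E.rng e)) :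
    B.act K (.edge e) (Finsupp.single x 1) = 0 := by
  simp [act, h]

theorem act_ghost_mem {e : A} {x : X} (h : x ∈ B.eset e) :
    B.act K (.ghost e) (Finsupp.single x 1) = Finsupp.single ((B.σ e).symm ⟨x, h⟩ : X) 1 := by
  simp [act, h]

theorem act_ghost_notMem {e : A} {x : X} (h : x ∉ B.eset e) :
    B.act K (.ghost e) (Finsupp.single x 1) = 0 := by
  simp [act, h]

theorem act_edge_ghost_mem {e : A} {x : X} (h : x ∈ B.eset e) :
    B.act K (.edge e) (B.act K (.ghost e) (Finsupp.single x 1)) = Finsupp.single x 1 := by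
  rw [act_ghost_mem K B h, act_edge_mem K B (Subtype.coe_prop _)]
  simp

theorem act_rel ⦃a b : FreeAlgebra K (Gen V A)⦄ (h : E.Rel K a b) :
    FreeAlgebra.lift K (B.act K) a = FreeAlgebra.lift K (B.act K) b := by
  have key : ∀ f g : Module.End K (X →₀ K),
      (∀ x, f (Finsupp.single x 1) = g (Finsupp.single x 1)) → f = g := by
    intro f g hfg
    ext x : 2
    simpa using hfg x
  apply key
  intro x
  cases h with
  | vv v =>
    simp only [map_mul, FreeAlgebra.lift_ι_apply, Module.End.mul_apply]
    by_cases hx : x ∈ B.vset v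
    · rw [act_vtx_mem K B hx, act_vtx_mem K B hx]
    · rw [act_vtx_notMem K B hx, map_zero]
  | vw v w hvw =>
    simp only [map_mul, FreeAlgebra.lift_ι_apply, Module.End.mul_apply, map_zero,
      LinearMap.zero_apply]
    by_cases hx : x ∈ B.vset w
    · rw [act_vtx_mem K B hx, act_vtx_notMem]
      exact fun hx' => Set.disjoint_left.1 (B.vset_disjoint v w hvw) hx' hx
    · rw [act_vtx_notMem K B hx, map_zero]
  | src_edge e =>
    simp only [map_mul, FreeAlgebra.lift_ι_apply, Module.End.mul_apply]
    by_cases hx : x ∈ B.vset (E.rng e)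
    · rw [act_edge_mem K B hx, act_vtx_mem]
      exact B.eset_subset e (Subtype.coe_prop _)
    · rw [act_edge_notMem K B hx, map_zero]
  | edge_rng e =>
    simp only [map_mul, FreeAlgebra.lift_ι_apply, Module.End.mul_apply]
    by_cases hx : x ∈ B.vset (E.rng e)
    · rw [act_vtx_mem K B hx]
    · rw [act_vtx_notMem K B hx, map_zero, act_edge_notMem K B hx]
  | rng_ghost e =>
    simp only [map_mul, FreeAlgebra.lift_ι_apply, Module.End.mul_apply]
    by_cases hx : x ∈ B.eset e
    · rw [act_ghost_mem K B hx, act_vtx_mem]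
      exact Subtype.coe_prop _
    · rw [act_ghost_notMem K B hx, map_zero]
  | ghost_src e =>
    simp only [map_mul, FreeAlgebra.lift_ι_apply, Module.End.mul_apply]
    by_cases hx : x ∈ B.vset (E.src e)
    · rw [act_vtx_mem K B hx]
    · rw [act_vtx_notMem K B hx, map_zero, act_ghost_notMem]
      exact fun h => hx (B.eset_subset e h)
  | ghost_edge e =>
    simp only [map_mul, FreeAlgebra.lift_ι_apply, Module.End.mul_apply]
    by_cases hx : x ∈ B.vset (E.rng e)
    · rw [act_edge_mem K B hx, act_vtx_mem K B hx, act_ghost_mem K B (Subtype.coe_prop _)]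
      simp
    · rw [act_edge_notMem K B hx, act_vtx_notMem K B hx, map_zero]
  | ghost_edge_ne e f hef =>
    simp only [map_mul, FreeAlgebra.lift_ι_apply, Module.End.mul_apply, map_zero,
      LinearMap.zero_apply]
    by_cases hx : x ∈ B.vset (E.rng f)
    · rw [act_edge_mem K B hx, act_ghost_notMem]
      exact fun h => Set.disjoint_left.1 (B.eset_disjoint e f hef) h (Subtype.coe_prop _)
    · rw [act_edge_notMem K B hx, map_zero]
  | ck2 v hfin hne =>
    simp only [map_sum, map_mul, FreeAlgebra.lift_ι_apply, LinearMap.sum_apply,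
      Module.End.mul_apply]
    have hreg : E.IsRegular v := ⟨hne.ne_empty, fun h => h hfin⟩
    by_cases hx : x ∈ B.vset v
    · rw [act_vtx_mem K B hx]
      rw [B.vset_eq v hreg] at hx
      simp only [Set.mem_iUnion] at hx
      obtain ⟨e, he, hxe⟩ := hx
      rw [Finset.sum_eq_single_of_mem e (hfin.mem_toFinset.2 he), act_edge_ghost_mem K B hxe]
      intro f _ hf
      rw [act_ghost_notMem, map_zero]
      exact fun h => Set.disjoint_left.1 (B.eset_disjoint f e hf) h hxe
    · rw [act_vtx_notMem K B hx, Finset.sum_eq_zero]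
      intro f hf
      rw [act_ghost_notMem, map_zero]
      intro h
      have h' := B.eset_subset f h
      rw [show E.src f = v from hfin.mem_toFinset.1 hf] at h'
      exact hx h'

/-- The module `M(X)`: the vector space with basis `X` and the action of `L_K(E)` induced by the
action of the generators. -/
noncomputable def rep : E.LPA K →ₙ+* AddMonoid.End (X →₀ K) :=
  (((Module.toAddMonoidEnd (Module.End K (X →₀ K)) (X →₀ K)).comp
    (RingQuot.liftAlgHom K ⟨FreeAlgebra.lift K (B.act K), B.act_rel K⟩ :
      E.UnitalLPA K →ₐ[K] Module.End K (X →₀ K)).toRingHom : E.UnitalLPA K →+* _) :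
        E.UnitalLPA K →ₙ+* _).comp
    (NonUnitalSubalgebraClass.subtype
      (NonUnitalAlgebra.adjoin K (Set.range (E.gen K))) : E.LPA K →ₙₐ[K] E.UnitalLPA K)

/-- The generators act on `M(X)` as prescribed. -/
theorem rep_lgen (g : Gen V A) (m : X →₀ K) : B.rep K (E.lgen K g) m = B.act K g m := by
  change RingQuot.liftAlgHom K (s := E.Rel K) ⟨FreeAlgebra.lift K (B.act K), B.act_rel K⟩
    (RingQuot.mkAlgHom K (E.Rel K) (FreeAlgebra.ι K g)) m = _
  rw [RingQuot.liftAlgHom_mkAlgHom_apply, FreeAlgebra.lift_ι_apply]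

end Branching

/-! ### The module of an infinite path -/

/-- The infinite path `eβ`. -/
def consPath (e : A) (β : ℕ → A) : ℕ → A
  | 0 => e
  | n + 1 => β n

theorem consPath_tail (α : ℕ → A) : consPath (α 0) (fun n => α (n + 1)) = α := by
  funext n
  cases n <;> rfl

theorem consPath_isInfPath {e : A} {β : ℕ → A} (hβ : E.IsInfPath β)
    (h : E.src (β 0) = E.rng e) : E.IsInfPath (consPath e β)
  | 0 => h.symm
  | n + 1 => hβ n

theorem TailEquiv.consPath {α β : ℕ → A} (e : A) (h : TailEquiv α β) :
    TailEquiv α (consPath e β) := by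
  obtain ⟨m, n, h⟩ := h
  refine ⟨m, n + 1, fun k => ?_⟩
  rw [h k, Nat.add_right_comm]
  rfl

theorem TailEquiv.tail {α β : ℕ → A} (h : TailEquiv α β) :
    TailEquiv α (fun n => β (n + 1)) := by
  obtain ⟨m, n, h⟩ := h
  refine ⟨m + 1, n, fun k => ?_⟩
  have := h (1 + k)
  rw [← Nat.add_assoc] at this
  rw [this]
  congr 1
  omega

/-- The set of the infinite paths which are tail equivalent to `α`. -/
@[ext]
structure InfX (α : ℕ → A) where
  path : ℕ → A
  isInfPath : E.IsInfPath path
  tailEquiv : TailEquiv α path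

/-- The branching system of the infinite paths which are tail equivalent to `α`. -/
def infBranching (α : ℕ → A) : E.Branching (E.InfX α) where
  vset v := {β | E.src (β.path 0) = v}
  eset e := {β | β.path 0 = e}
  σ e :=
    { toFun := fun β => ⟨⟨consPath e β.1.path, E.consPath_isInfPath β.1.isInfPath β.2,
        β.1.tailEquiv.consPath e⟩, rfl⟩
      invFun := fun β => ⟨⟨fun n => β.1.path (n + 1), fun n => β.1.isInfPath (n + 1),
        β.1.tailEquiv.tail⟩, (β.1.isInfPath 0).symm.trans (congrArg E.rng β.2)⟩
      left_inv := fun _ => rfl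
      right_inv := by
        rintro ⟨β, rfl⟩
        exact Subtype.ext (InfX.ext (consPath_tail β.path)) }
  vset_disjoint _ _ h := Set.disjoint_left.2 fun _ h₁ h₂ => h (h₁.symm.trans h₂)
  eset_disjoint _ _ h := Set.disjoint_left.2 fun _ h₁ h₂ => h (h₁.symm.trans h₂)
  eset_subset _ _ h := congrArg E.src h
  vset_eq v _ := by
    ext β
    simp [out]

variable (K) in
/-- The module `V_[α]`. -/
noncomputable def repV (α : ℕ → A) : E.LPA K →ₙ+* AddMonoid.End (E.InfX α →₀ K) :=
  (E.infBranching α).rep K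

/-! ### The module of a sink or of an infinite emitter -/

/-- The set of the paths which end at `v`; a path is given by its source and its edge list. -/
@[ext]
structure FinX (v : V) where
  start : V
  edges : List A
  isPath : E.IsPath start edges v

/-- The branching system of the paths which end at `v`, for a sink or an infinite emitter `v`. -/
def finBranching (v : V) (hv : ¬ E.IsRegular v) : E.Branching (E.FinX v) where
  vset w := {x | x.start = w}
  eset e := {x | ∃ l, x.edges = e :: l}
  σ e :=
    { toFun := fun x => ⟨⟨E.src e, e :: x.1.edges, rfl, by
        obtain ⟨x, hx : x.start = _⟩ := x
        have h := x.isPath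
        rw [hx] at h
        exact h⟩, _, rfl⟩
      invFun := fun x => ⟨⟨E.rng e, x.1.edges.tail, by
        obtain ⟨⟨u, l, hl⟩, m, hx : l = e :: m⟩ := x
        subst hx
        exact hl.2⟩, rfl⟩
      left_inv := by
        rintro ⟨⟨u, l, hl⟩, hx : u = _⟩
        subst hx
        rfl
      right_inv := by
        rintro ⟨⟨u, l, hl⟩, m, hx : l = e :: m⟩
        subst hx
        exact Subtype.ext (FinX.ext hl.1 rfl) }
  vset_disjoint _ _ h := Set.disjoint_left.2 fun _ h₁ h₂ => h (h₁.symm.trans h₂)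
  eset_disjoint _ _ h := Set.disjoint_left.2 fun _ ⟨_, h₁⟩ ⟨_, h₂⟩ =>
    h (List.cons.inj (h₁.symm.trans h₂)).1
  eset_subset e x h := by
    obtain ⟨u, l, hl⟩ := x
    obtain ⟨m, hx : l = e :: m⟩ := h
    subst hx
    exact hl.1.symm
  vset_eq w hw := by
    ext ⟨u, l, hl⟩
    rw [Set.mem_iUnion₂]
    constructor
    · intro (h : u = w)
      cases l with
      | nil =>
        refine absurd hw ?_
        rw [← h, show u = v from hl]
        exact hv
      | cons f l => exact ⟨f, hl.1.trans h, l, rfl⟩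
    · rintro ⟨e, he, m, hx : l = e :: m⟩
      subst hx
      exact hl.1.symm.trans he

variable (K) in
/-- The module `N_v`, for a sink or an infinite emitter `v`. -/
noncomputable def repN (v : V) (hv : ¬ E.IsRegular v) :
    E.LPA K →ₙ+* AddMonoid.End (E.FinX v →₀ K) :=
  (E.finBranching v hv).rep K

variable {E} in
theorem IsSink.not_isRegular {v : V} (h : E.IsSink v) : ¬ E.IsRegular v := fun h' => h'.1 h

variable {E} in
theorem IsInfiniteEmitter.not_isRegular {v : V} (h : E.IsInfiniteEmitter v) :
    ¬ E.IsRegular v := fun h' => h'.2 h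

/-! ### The module of an exclusive cycle -/

open Classical in
/-- Removes the longest common prefix of two lists. -/
noncomputable def stripPrefix : List A → List A → List A × List A
  | e :: p, f :: q => if e = f then stripPrefix p q else (e :: p, f :: q)
  | [], q => ([], q)
  | p, [] => (p, [])

/-- The reduction function: `pq*` is replaced by `p'q'*` as long as `p = p'e` and `q = q'e` for
an edge `e`. -/
noncomputable def red (p q : List A) : List A × List A :=
  ((stripPrefix p.reverse q.reverse).1.reverse, (stripPrefix p.reverse q.reverse).2.reverse)

/-- The elements `pq*` of `Y`: `p` is a path with source `u`, `q` is a path with source `v`, and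
`p` and `q` end at the same vertex of `c`. -/
def MemY (c : List A) (v u : V) (p q : List A) : Prop :=
  ∃ w ∈ E.cycVerts c, E.IsPath u p w ∧ E.IsPath v q w

/-- The set of the reduced elements `pq*` of `Y`. -/
@[ext]
structure CycX (c : List A) (v : V) where
  start : V
  p : List A
  q : List A
  memY : E.MemY c v start p q
  reduced : red p q = (p, q)

theorem stripPrefix_idem (p q : List A) :
    stripPrefix (stripPrefix p q).1 (stripPrefix p q).2 = stripPrefix p q := by
  induction p generalizing q with
  | nil => simp [stripPrefix]
  | cons e p ih =>
    cases q with
    | nil => simp [stripPrefix]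
    | cons f q =>
      by_cases h : e = f
      · simp [stripPrefix, h, ih]
      · simp [stripPrefix, h]

theorem stripPrefix_snoc (p q : List A) (g : A) :
    stripPrefix ((stripPrefix p q).1 ++ [g]) (stripPrefix p q).2 = stripPrefix (p ++ [g]) q := by
  induction p generalizing q with
  | nil => simp [stripPrefix]
  | cons e p ih =>
    cases q with
    | nil => simp [stripPrefix]
    | cons f q =>
      by_cases h : e = f
      · simp [stripPrefix, h, ih]
      · simp [stripPrefix, h]

theorem stripPrefix_snoc_fst (p q : List A) (g : A) :
    (stripPrefix (p ++ [g]) q).1 = [] ∨ ∃ p', (stripPrefix (p ++ [g]) q).1 = p' ++ [g] := by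
  induction p generalizing q with
  | nil =>
    cases q with
    | nil => exact Or.inr ⟨[], by simp [stripPrefix]⟩
    | cons f q =>
      by_cases h : g = f
      · simp [stripPrefix, h]
      · exact Or.inr ⟨[], by simp [stripPrefix, h]⟩
  | cons e p ih =>
    cases q with
    | nil => exact Or.inr ⟨e :: p, by simp [stripPrefix]⟩
    | cons f q =>
      by_cases h : e = f
      · simpa [stripPrefix, h] using ih q
      · exact Or.inr ⟨e :: p, by simp [stripPrefix, h]⟩

theorem stripPrefix_length (p q : List A) : (stripPrefix p q).1.length ≤ p.length := by
  induction p generalizing q with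
  | nil => simp [stripPrefix]
  | cons e p ih =>
    cases q with
    | nil => simp [stripPrefix]
    | cons f q =>
      by_cases h : e = f
      · simpa [stripPrefix, h] using (ih q).trans (Nat.le_succ _)
      · simp [stripPrefix, h]

theorem stripPrefix_snoc_inj (p q p' q' : List A) (g : A)
    (h : stripPrefix p q = (p, q)) (h' : stripPrefix p' q' = (p', q'))
    (heq : stripPrefix (p ++ [g]) q = stripPrefix (p' ++ [g]) q') : p = p' ∧ q = q' := by
  have key : ∀ p q : List A, stripPrefix p q = (p, q) →
      (stripPrefix (p ++ [g]) q = (p ++ [g], q) ∨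
        p = [] ∧ ∃ r, q = g :: r ∧ stripPrefix (p ++ [g]) q = ([], r)) := by
    intro p q h
    cases p with
    | nil =>
      cases q with
      | nil => simp [stripPrefix]
      | cons f q =>
        by_cases hf : g = f
        · simp [stripPrefix, hf]
        · simp [stripPrefix, hf]
    | cons e p =>
      cases q with
      | nil => simp [stripPrefix]
      | cons f q =>
        by_cases hf : e = f
        · exfalso
          have := stripPrefix_length p q
          simp only [stripPrefix, hf, if_true] at h
          rw [h] at this
          simp at this
        · simp [stripPrefix, hf]
  rcases key p q h with h₁ | ⟨h₁, r, h₂, h₃⟩ <;>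
    rcases key p' q' h' with h₁' | ⟨h₁', r', h₂', h₃'⟩
  · rw [h₁, h₁'] at heq
    simpa using heq
  · rw [h₁, h₃'] at heq
    simp at heq
  · rw [h₃, h₁'] at heq
    simp at heq
  · rw [h₃, h₃'] at heq
    simp_all

theorem red_idem (p q : List A) : red (red p q).1 (red p q).2 = red p q := by
  simp [red, stripPrefix_idem]

theorem red_cons_red (p q : List A) (e : A) :
    red (e :: (red p q).1) (red p q).2 = red (e :: p) q := by
  simp [red, stripPrefix_snoc]

theorem red_cons_fst (p q : List A) (e : A) :
    (red (e :: p) q).1 = [] ∨ ∃ p', (red (e :: p) q).1 = e :: p' := by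
  rcases stripPrefix_snoc_fst p.reverse q.reverse e with h | ⟨p', h⟩
  · left
    simp [red, h]
  · right
    exact ⟨p'.reverse, by simp [red, h]⟩

theorem red_reduced {p q : List A} (h : red p q = (p, q)) :
    stripPrefix p.reverse q.reverse = (p.reverse, q.reverse) := by
  have h₁ := congrArg (fun x => x.1.reverse) h
  have h₂ := congrArg (fun x => x.2.reverse) h
  simp only [red, List.reverse_reverse] at h₁ h₂
  exact Prod.ext h₁ h₂

theorem red_cons_inj {p q p' q' : List A} {e : A} (h : red p q = (p, q))
    (h' : red p' q' = (p', q')) (heq : red (e :: p) q = red (e :: p') q') :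
    p = p' ∧ q = q' := by
  have h₁ := congrArg (fun x => x.1.reverse) heq
  have h₂ := congrArg (fun x => x.2.reverse) heq
  simp only [red, List.reverse_reverse, List.reverse_cons] at h₁ h₂
  have := stripPrefix_snoc_inj _ _ _ _ e (red_reduced h) (red_reduced h') (Prod.ext h₁ h₂)
  simpa using this

theorem red_singleton_snoc (q : List A) (e : A) : red [e] (q ++ [e]) = ([], q) := by
  simp [red, stripPrefix]

theorem isPath_append {u w : V} {l m : List A} :
    E.IsPath u (l ++ m) w ↔ ∃ x, E.IsPath u l x ∧ E.IsPath x m w := by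
  induction l generalizing u with
  | nil => simp [IsPath]
  | cons e l ih => simp [IsPath, ih, and_assoc]

theorem isPath_rng {u w : V} {l : List A} (h : E.IsPath u l w) {e : A} (he : e ∈ l) :
    E.rng e = w ∨ ∃ f ∈ l, E.src f = E.rng e := by
  induction l generalizing u with
  | nil => simp at he
  | cons g l ih =>
    rcases List.mem_cons.1 he with rfl | he
    · cases l with
      | nil => exact Or.inl h.2
      | cons f l => exact Or.inr ⟨f, by simp, h.2.1⟩
    · rcases ih h.2 he with h | ⟨f, hf, h⟩
      · exact Or.inl h
      · exact Or.inr ⟨f, by simp [hf], h⟩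

theorem rng_mem_cycVerts {v : V} {c : List A} (hc : E.IsCycleAt v c) {e : A} (he : e ∈ c) :
    E.rng e ∈ E.cycVerts c := by
  rcases E.isPath_rng hc.2.1 he with h | ⟨f, hf, h⟩
  · cases c with
    | nil => simp at he
    | cons g c => exact ⟨g, by simp, hc.2.1.1.trans h.symm⟩
  · exact ⟨f, hf, h⟩

/-- The segment of a cycle from one of its vertices to another. -/
theorem exists_segment {v : V} {c : List A} (hc : E.IsCycleAt v c) {x y : V}
    (hx : x ∈ E.cycVerts c) (hy : y ∈ E.cycVerts c) :
    ∃ l, E.IsPath x l y ∧ (l.map E.src).Nodup ∧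
      ∀ f ∈ l, E.src f ∈ E.cycVerts c ∧ E.src f ≠ y := by
  obtain ⟨-, hp, hnd⟩ := hc
  obtain ⟨g, hg, rfl⟩ := hx
  obtain ⟨a, b, rfl⟩ := List.append_of_mem hg
  obtain ⟨z, h₁, h₂⟩ := E.isPath_append.1 hp
  have hz : E.src g = z := h₂.1
  have hp' : E.IsPath (E.src g) ((g :: b) ++ a) (E.src g) :=
    E.isPath_append.2 ⟨v, hz ▸ h₂, hz ▸ h₁⟩
  have hnd' : (((g :: b) ++ a).map E.src).Nodup := by
    refine (List.Perm.nodup_iff ?_).1 hnd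
    exact (List.perm_append_comm).map _
  have hmem : ∀ f, f ∈ a ++ g :: b ↔ f ∈ (g :: b) ++ a := fun f =>
    List.perm_append_comm.mem_iff
  obtain ⟨h, hh, rfl⟩ := hy
  generalize hc' : (g :: b) ++ a = c' at hp' hnd' hmem
  obtain ⟨l, m, rfl⟩ := List.append_of_mem ((hmem h).1 hh)
  obtain ⟨z', h₁', h₂'⟩ := E.isPath_append.1 hp'
  have hz' : E.src h = z' := h₂'.1
  rw [List.map_append, List.map_cons] at hnd'
  refine ⟨l, hz' ▸ h₁', (List.nodup_append.1 hnd').1, fun f hf => ⟨⟨f, ?_, rfl⟩, ?_⟩⟩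
  · exact (hmem f).2 (by simp [hf])
  · exact (List.nodup_append.1 hnd').2.2 _ (List.mem_map_of_mem hf) _ (by simp)

/-- A path from `u` to a set of vertices can be chosen without repetitions, and so that it does
not meet the set before its end. -/
theorem exists_simple {u : V} {S : Set V} (h : ∃ l, ∃ w ∈ S, E.IsPath u l w) :
    ∃ l, ∃ w ∈ S, E.IsPath u l w ∧ (l.map E.src).Nodup ∧ ∀ f ∈ l, E.src f ∉ S := by
  obtain ⟨l, hl⟩ := h
  induction hn : l.length using Nat.strong_induction_on generalizing u l with
  | _ n ih =>
    obtain ⟨w, hw, hp⟩ := hl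
    by_cases hu : u ∈ S
    · exact ⟨[], u, hu, rfl, by simp, by simp⟩
    cases l with
    | nil => exact absurd (show u = w from hp ▸ rfl) (fun h => hu (h ▸ hw))
    | cons e l =>
      obtain ⟨m, x, hx, hm, hnd, hS⟩ := ih l.length (by simp [← hn]) l ⟨w, hw, hp.2⟩ rfl
      by_cases hrep : ∃ f ∈ m, E.src f = u
      · obtain ⟨f, hf, rfl⟩ := hrep
        obtain ⟨a, b, rfl⟩ := List.append_of_mem hf
        obtain ⟨z, -, h₂⟩ := E.isPath_append.1 hm
        have hz : E.src f = z := h₂.1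
        refine ⟨f :: b, x, hx, hz ▸ h₂, ?_, fun g hg => hS g (by simp_all)⟩
        rw [List.map_append] at hnd
        exact (List.nodup_append.1 hnd).2.1
      · refine ⟨e :: m, x, hx, ⟨hp.1, hm⟩, ?_, ?_⟩
        · rw [List.map_cons, List.nodup_cons]
          refine ⟨?_, hnd⟩
          rw [hp.1]
          simpa using hrep
        · intro f hf
          rcases List.mem_cons.1 hf with rfl | hf
          · rw [hp.1]
            exact hu
          · exact hS f hf

variable {E}

/-- An edge which starts on an exclusive cycle and from whose range the cycle can be reached is
an edge of the cycle. -/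
theorem IsExclusive.mem {c : List A} (hc : E.IsExclusive c) {e : A}
    (he : E.src e ∈ E.cycVerts c) (hr : ∃ l, ∃ w ∈ E.cycVerts c, E.IsPath (E.rng e) l w) :
    e ∈ c := by
  obtain ⟨⟨v, hv⟩, hex⟩ := hc
  obtain ⟨l, w, hw, hl, hnd, hlc⟩ := E.exists_simple hr
  obtain ⟨m, hm, hnd', hmc⟩ := E.exists_segment hv hw he
  have hcyc : E.IsCycleAt (E.src e) (e :: (l ++ m)) := by
    refine ⟨by simp, ⟨rfl, E.isPath_append.2 ⟨w, hl, hm⟩⟩, ?_⟩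
    rw [List.map_cons, List.nodup_cons, List.map_append, List.nodup_append]
    refine ⟨?_, hnd, hnd', ?_⟩
    · rw [List.mem_append, List.mem_map, List.mem_map]
      rintro (⟨f, hf, h⟩ | ⟨f, hf, h⟩)
      · exact hlc f hf (h ▸ he)
      · exact (hmc f hf).2 h
    · intro a ha b hb hab
      obtain ⟨f, hf, rfl⟩ := List.mem_map.1 ha
      obtain ⟨g, hg, rfl⟩ := List.mem_map.1 hb
      exact hlc f hf (hab ▸ (hmc g hg).1)
  exact (hex _ he _ hcyc).mem_iff.1 (by simp)

theorem IsExclusive.eq_of_src_eq {c : List A} (hc : E.IsExclusive c) {e f : A} (he : e ∈ c)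
    (hf : f ∈ c) (h : E.src e = E.src f) : e = f := by
  obtain ⟨⟨v, hv⟩, -⟩ := hc
  exact List.inj_on_of_nodup_map hv.2.2 he hf h

theorem IsExclusive.vert_mem {c : List A} (hc : E.IsExclusive c) {v w : V} {q : List A}
    (hv : v ∈ E.cycVerts c) (hq : E.IsPath v q w)
    (hw : ∃ l, ∃ x ∈ E.cycVerts c, E.IsPath w l x) : w ∈ E.cycVerts c := by
  induction q generalizing v with
  | nil => exact (show v = w from hq) ▸ hv
  | cons e q ih =>
    obtain ⟨l, x, hx, hl⟩ := hw
    have he : e ∈ c := hc.mem (hq.1.symm ▸ hv) ⟨q ++ l, x, hx, E.isPath_append.2 ⟨w, hq.2, hl⟩⟩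
    obtain ⟨⟨u, hu⟩, -⟩ := hc
    exact ih (E.rng_mem_cycVerts hu he) hq.2

theorem MemY.red {c : List A} (hc : E.IsExclusive c) {v : V} (hv : v ∈ E.cycVerts c) {u : V}
    {p q : List A} (h : E.MemY c v u p q) :
    E.MemY c v u (DirGraph.red p q).1 (DirGraph.red p q).2 := by
  have key : ∀ P Q : List A, E.MemY c v u P.reverse Q.reverse →
      E.MemY c v u (stripPrefix P Q).1.reverse (stripPrefix P Q).2.reverse := by
    intro P
    induction P with
    | nil =>
      intro Q h
      simpa [stripPrefix] using h
    | cons e P ih =>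
      intro Q h
      cases Q with
      | nil => simpa [stripPrefix] using h
      | cons f Q =>
        by_cases hef : e = f
        · subst hef
          simp only [stripPrefix, if_true]
          apply ih
          obtain ⟨w, hw, h₁, h₂⟩ := h
          rw [List.reverse_cons, isPath_append] at h₁ h₂
          obtain ⟨x, h₁, hx, hx'⟩ := h₁
          obtain ⟨y, h₂, hy, hy'⟩ := h₂
          subst hx
          have hy : E.src e = y := hy
          subst hy
          exact ⟨E.src e, hc.vert_mem hv h₂ ⟨[e], w, hw, rfl, hx'⟩, h₁, h₂⟩
        · simpa [stripPrefix, hef] using h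
  simpa [DirGraph.red] using key p.reverse q.reverse (by simpa using h)

theorem MemY.cons {c : List A} {v : V} {e : A} {p q : List A}
    (h : E.MemY c v (E.rng e) p q) : E.MemY c v (E.src e) (e :: p) q := by
  obtain ⟨w, hw, h₁, h₂⟩ := h
  exact ⟨w, hw, ⟨rfl, h₁⟩, h₂⟩

/-- The map `pq* ↦ red(epq*)` on the elements `pq*` of `Y` with `s(p) = r(e)`. -/
noncomputable def cycStep {c : List A} (hc : E.IsExclusive c) {v : V} (hv : v ∈ E.cycVerts c)
    (e : A) (p q : List A) (h : E.MemY c v (E.rng e) p q) : E.CycX c v where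
  start := E.src e
  p := (red (e :: p) q).1
  q := (red (e :: p) q).2
  memY := h.cons.red hc hv
  reduced := red_idem _ _

/-- The set `X_e` of the elements of the form `red(ers*)` with `ers*` in `Y`. -/
def cycEset {c : List A} (hc : E.IsExclusive c) {v : V} (hv : v ∈ E.cycVerts c) (e : A) :
    Set (E.CycX c v) :=
  {x | ∃ r s, ∃ h : E.MemY c v (E.rng e) r s, x = cycStep hc hv e r s h}

theorem mem_of_mem_cycEset {c : List A} (hc : E.IsExclusive c) {v : V}
    (hv : v ∈ E.cycVerts c) {e : A} {x : E.CycX c v} (h : x ∈ cycEset hc hv e)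
    (hx : x.start ∈ E.cycVerts c) : e ∈ c := by
  obtain ⟨r, s, hY, hxe⟩ := h
  obtain ⟨w, hw, hr, -⟩ := id hY
  have he : x.start = E.src e := congrArg CycX.start hxe
  exact hc.mem (he ▸ hx) ⟨r, w, hw, hr⟩

theorem cycStep_bijective {c : List A} (hc : E.IsExclusive c) {v : V} (hv : v ∈ E.cycVerts c)
    (e : A) : Function.Bijective
      (fun x : {x : E.CycX c v | x.start = E.rng e} =>
        (⟨cycStep hc hv e x.1.p x.1.q
          (Eq.subst (motive := fun u => E.MemY c v u x.1.p x.1.q) x.2 x.1.memY), x.1.p, x.1.q, _, rfl⟩ :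
          cycEset hc hv e)) := by
  constructor
  · rintro ⟨x, hx⟩ ⟨y, hy⟩ h
    have h' := congrArg Subtype.val h
    have h₁ := red_cons_inj x.reduced y.reduced
      (Prod.ext (congrArg CycX.p h') (congrArg CycX.q h'))
    exact Subtype.ext (CycX.ext (hx.trans hy.symm) h₁.1 h₁.2)
  · rintro ⟨x, r, s, h, rfl⟩
    refine ⟨⟨⟨E.rng e, (red r s).1, (red r s).2, h.red hc hv, red_idem r s⟩, rfl⟩, ?_⟩
    have := red_cons_red r s e
    exact Subtype.ext (CycX.ext rfl (congrArg Prod.fst this) (congrArg Prod.snd this))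

/-- The branching system `X^v` of an exclusive cycle `c` and a vertex `v` of `c`. -/
noncomputable def cycBranching {c : List A} (hc : E.IsExclusive c) {v : V}
    (hv : v ∈ E.cycVerts c) : E.Branching (E.CycX c v) where
  vset w := {x | x.start = w}
  eset e := cycEset hc hv e
  σ e := Equiv.ofBijective _ (cycStep_bijective hc hv e)
  vset_disjoint _ _ h := Set.disjoint_left.2 fun _ h₁ h₂ => h (h₁.symm.trans h₂)
  eset_disjoint e f hef := Set.disjoint_left.2 fun x h₁ h₂ => by
    apply hef
    rcases hp : x.p with _ | ⟨g, p⟩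
    · have hx : x.start ∈ E.cycVerts c := by
        obtain ⟨w, hw, h, -⟩ := x.memY
        rw [hp] at h
        exact (show x.start = w from h) ▸ hw
      refine hc.eq_of_src_eq (mem_of_mem_cycEset hc hv h₁ hx)
        (mem_of_mem_cycEset hc hv h₂ hx) ?_
      obtain ⟨r, s, h, rfl⟩ := h₁
      obtain ⟨r', s', h', hx'⟩ := h₂
      exact congrArg CycX.start hx'
    · have aux : ∀ e, x ∈ cycEset hc hv e → g = e := by
        rintro e ⟨r, s, h, hx⟩
        have hx' : x.p = (red (e :: r) s).1 := congrArg CycX.p hx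
        rw [hp] at hx'
        rcases red_cons_fst r s e with h | ⟨p', h⟩
        · rw [h] at hx'
          simp at hx'
        · rw [h] at hx'
          exact (List.cons.inj hx').1
      exact (aux e h₁).symm.trans (aux f h₂)
  eset_subset e x h := by
    obtain ⟨r, s, h, rfl⟩ := h
    rfl
  vset_eq w _ := by
    ext x
    rw [Set.mem_iUnion₂]
    constructor
    · intro (hx : x.start = w)
      obtain ⟨z, hz, h₁, h₂⟩ := x.memY
      rcases hp : x.p with _ | ⟨e, p⟩
      · rw [hp] at h₁
        have h₁ : x.start = z := h₁
        obtain ⟨e, he, hez⟩ := id hz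
        obtain ⟨⟨u, hu⟩, -⟩ := id hc
        have hY : E.MemY c v (E.rng e) [] (x.q ++ [e]) :=
          ⟨E.rng e, E.rng_mem_cycVerts hu he, rfl, E.isPath_append.2 ⟨z, h₂, hez, rfl⟩⟩
        refine ⟨e, (hez.trans h₁.symm).trans hx, [], x.q ++ [e], hY, ?_⟩
        have := red_singleton_snoc x.q e
        refine CycX.ext (h₁.trans hez.symm) ?_ ?_
        · rw [hp]
          exact (congrArg Prod.fst this).symm
        · exact (congrArg Prod.snd this).symm
      · rw [hp] at h₁
        refine ⟨e, h₁.1.trans hx, p, x.q, ⟨z, hz, h₁.2, h₂⟩, ?_⟩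
        have := x.reduced
        rw [hp] at this
        refine CycX.ext h₁.1.symm ?_ ?_
        · rw [hp]
          exact (congrArg Prod.fst this).symm
        · exact (congrArg Prod.snd this).symm
    · rintro ⟨e, he, r, s, h, rfl⟩
      exact he

variable (K) in
/-- The module `N_c = N_c^v`, for an exclusive cycle `c` and a vertex `v` of `c`. -/
noncomputable def repC {c : List A} (hc : E.IsExclusive c) {v : V} (hv : v ∈ E.cycVerts c) :
    E.LPA K →ₙ+* AddMonoid.End (E.CycX c v →₀ K) :=
  (cycBranching hc hv).rep K

/-! ### The four types of graded Chen modules -/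

/-- The four types of graded Chen modules. -/
inductive ChenType
  | strictlyDecreasing
  | relativeSink
  | extremeCycle
  | exclusiveCycle

/-- `P` is the annihilator of a graded Chen module of the given type. -/
def IsGradedChenAnn (P : Set (E.LPA K)) : ChenType → Prop
  | .strictlyDecreasing =>
      ∃ α, E.IsStrictlyDecreasing α ∧
        (∀ v ∈ E.root (E.infVerts α), E.root {v} ⊂ E.root (E.infVerts α)) ∧
        P = ann (E.repV K α)
  | .relativeSink =>
      (∃ v, ∃ hv : E.IsSink v, P = ann (E.repN K v hv.not_isRegular)) ∨
      (∃ v, ∃ hv : E.IsInfiniteEmitter v, E.returnEdges v = ∅ ∧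
        P = ann (E.repN K v hv.not_isRegular))
  | .extremeCycle =>
      (∃ α, E.IsInfPath α ∧ ¬ E.IsRational α ∧
        (∀ w ∈ E.infVerts α, ∃ c, w ∈ E.cycVerts c ∧
          E.IsExtremeIn c (E.root (E.infVerts α))) ∧
        P = ann (E.repV K α)) ∨
      (∃ v, ∃ hv : E.IsInfiniteEmitter v, (E.returnEdges v).Infinite ∧
        P = ann (E.repN K v hv.not_isRegular)) ∨
      (∃ v, ∃ hv : E.IsInfiniteEmitter v, (E.returnEdges v).Finite ∧
        1 < (E.returnEdges v).ncard ∧ P = ann (E.repN K v hv.not_isRegular))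
  | .exclusiveCycle =>
      (∃ c, ∃ hc : E.IsExclusive c, ∃ v, ∃ hv : v ∈ E.cycVerts c, P = ann (repC K hc hv)) ∨
      (∃ v, ∃ hv : E.IsInfiniteEmitter v, (E.returnEdges v).ncard = 1 ∧
        P = ann (E.repN K v hv.not_isRegular))

end DirGraph

/-! Call the kernel of a representation graded if it contains every homogeneous component of each of
its elements. Such a kernel is determined by two sets of vertices: the set W of the vertices that do
not act as zero (`support`), and the set D of the v with only finitely many edges to W for which v -
∑ ee*, summed over these edges, does not act as zero (`gapVerts`). This is
`map_eq_zero_iff_of_support_eq`: a homogeneous element is broken up by multiplication with edges and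
ghost edges, by induction on the length of its monomials pq*, until only gap elements v - ∑ ee*
remain. It therefore suffices to work with pairs (W, D). They can be read off from a branching
system (`mem_support_rep`, `mem_gapVerts_rep`), and the kernel is graded once the basis has a
compatible degree function (`kerGraded_rep`).

Let M be graded simple. Every homogeneous x with Lx ≠ 0 generates M. At a gap vertex v there is such
an x killed by all ghost paths of positive length, so M is spanned by the px with p ending at v;
hence D = {v} and W = R(v). In general, writing one fixed vector as c·z with z = uz, for every u in
W, shows that any v in W reaches a countable subset of W which every u in W reaches
(`exists_countable`). In particular W is directed.

Existence of a type is now graph theory. If D = {v}, then M and N_v have the same annihilator, and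
the number of return edges of v decides the type. If D is empty, every vertex of W has an edge into
W, and there are three cases. If W is not the root of any of its vertices, countable cofinality and
directedness produce a strictly decreasing path with root W. If W = R(w) for some w in W with two
edges into W, two closed paths at w start differently, and a concatenation of them that is not
eventually periodic runs through extreme cycles only. If W is the root of one of its vertices but
such vertices never branch inside W, then W is the root of an exclusive cycle.

Uniqueness holds because each type forces a condition on (W, D), stated in `HasType`, and the four
conditions exclude one another when D has at most one element. -/

namespace DirGraph

variable {V A K : Type*} [Field K] {E : DirGraph V A}

local notation "𝓋[" v "]" => DirGraph.lgen E K (Gen.vtx v)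
local notation "ℯ[" e "]" => DirGraph.lgen E K (Gen.edge e)
local notation "ℊ[" e "]" => DirGraph.lgen E K (Gen.ghost e)

/-! ### Subtraction in the Leavitt path algebra

The general lemmas hold for the subtraction of `L_K(E)` by unfolding instances which `rw` does
not unfold. -/

theorem lpa_mul_sub (a b c : E.LPA K) : a * (b - c) = a * b - a * c := mul_sub a b c

theorem lpa_sub_mul (a b c : E.LPA K) : (a - b) * c = a * c - b * c := sub_mul a b c

theorem lpa_sub_self (a : E.LPA K) : a - a = 0 := sub_self a

theorem lpa_sub_zero (a : E.LPA K) : a - 0 = a := sub_zero a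

theorem lpa_map_sub {R : Type*} [NonUnitalNonAssocRing R] (φ : E.LPA K →ₙ+* R) (a b : E.LPA K) :
    φ (a - b) = φ a - φ b := map_sub φ a b

/-! ### Relations in the Leavitt path algebra -/

theorem vtx_mul_self (v : V) : 𝓋[v] * 𝓋[v] = 𝓋[v] :=
  Subtype.ext (by
    have := RingQuot.mkAlgHom_rel K (Rel.vv (E := E) (K := K) v)
    rwa [map_mul] at this)

theorem vtx_mul_ne {v w : V} (h : v ≠ w) : 𝓋[v] * 𝓋[w] = 0 :=
  Subtype.ext (by
    have := RingQuot.mkAlgHom_rel K (Rel.vw (E := E) (K := K) v w h)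
    rwa [map_mul, map_zero] at this)

theorem src_mul_edge (e : A) : 𝓋[E.src e] * ℯ[e] = ℯ[e] :=
  Subtype.ext (by
    have := RingQuot.mkAlgHom_rel K (Rel.src_edge (E := E) (K := K) e)
    rwa [map_mul] at this)

theorem edge_mul_rng (e : A) : ℯ[e] * 𝓋[E.rng e] = ℯ[e] :=
  Subtype.ext (by
    have := RingQuot.mkAlgHom_rel K (Rel.edge_rng (E := E) (K := K) e)
    rwa [map_mul] at this)

theorem rng_mul_ghost (e : A) : 𝓋[E.rng e] * ℊ[e] = ℊ[e] :=
  Subtype.ext (by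
    have := RingQuot.mkAlgHom_rel K (Rel.rng_ghost (E := E) (K := K) e)
    rwa [map_mul] at this)

theorem ghost_mul_src (e : A) : ℊ[e] * 𝓋[E.src e] = ℊ[e] :=
  Subtype.ext (by
    have := RingQuot.mkAlgHom_rel K (Rel.ghost_src (E := E) (K := K) e)
    rwa [map_mul] at this)

theorem ghost_mul_edge (e : A) : ℊ[e] * ℯ[e] = 𝓋[E.rng e] :=
  Subtype.ext (by
    have := RingQuot.mkAlgHom_rel K (Rel.ghost_edge (E := E) (K := K) e)
    rwa [map_mul] at this)

theorem ghost_mul_edge_ne {e f : A} (h : e ≠ f) : ℊ[e] * ℯ[f] = 0 :=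
  Subtype.ext (by
    have := RingQuot.mkAlgHom_rel K (Rel.ghost_edge_ne (E := E) (K := K) e f h)
    rwa [map_mul, map_zero] at this)

theorem vtx_eq_sum (v : V) (hfin : (E.out v).Finite) (hne : (E.out v).Nonempty) :
    𝓋[v] = ∑ e ∈ hfin.toFinset, ℯ[e] * ℊ[e] :=
  Subtype.ext (by
    have := RingQuot.mkAlgHom_rel K (Rel.ck2 (E := E) (K := K) v hfin hne)
    rw [map_sum] at this
    simp only [map_mul] at this
    rw [AddSubmonoidClass.coe_finsetSum]
    exact this)

theorem vtx_mul_edge_ne {v : V} {e : A} (h : v ≠ E.src e) : 𝓋[v] * ℯ[e] = 0 := by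
  rw [← src_mul_edge e, ← mul_assoc, vtx_mul_ne h, zero_mul]

theorem ghost_mul_vtx_ne {v : V} {e : A} (h : E.src e ≠ v) : ℊ[e] * 𝓋[v] = 0 := by
  rw [← ghost_mul_src e, mul_assoc, vtx_mul_ne h, mul_zero]

variable (K) in
theorem vtx_mul_pathElt {u w : V} {p : List A} (hp : E.IsPath u p w) :
    𝓋[u] * E.pathElt K u p = E.pathElt K u p := by
  cases p with
  | nil => exact vtx_mul_self u
  | cons e p =>
    obtain ⟨rfl, -⟩ := hp
    rw [pathElt, ← mul_assoc, src_mul_edge]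

variable (K) in
theorem ghostElt_mul_vtx {u w : V} {p : List A} (hp : E.IsPath u p w) :
    E.ghostElt K u p * 𝓋[u] = E.ghostElt K u p := by
  cases p with
  | nil => exact vtx_mul_self u
  | cons e p =>
    obtain ⟨rfl, -⟩ := hp
    rw [ghostElt, mul_assoc, ghost_mul_src]

variable (K) in
theorem vtx_mul_ghostElt {u w : V} {p : List A} (hp : E.IsPath u p w) :
    𝓋[w] * E.ghostElt K u p = E.ghostElt K u p := by
  induction p generalizing u with
  | nil =>
    obtain rfl : u = w := hp
    exact vtx_mul_self u
  | cons e p ih => rw [ghostElt, ← mul_assoc, ih hp.2]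

theorem ghostElt_snoc {u : V} {q : List A} {e : A} (hq : E.IsPath u q (E.src e)) :
    E.ghostElt K u (q ++ [e]) = ℊ[e] * E.ghostElt K u q := by
  induction q generalizing u with
  | nil =>
    obtain rfl : u = E.src e := hq
    rw [List.nil_append, ghostElt, ghostElt, ghostElt, rng_mul_ghost, ghost_mul_src]
  | cons f q ih => rw [List.cons_append, ghostElt, ghostElt, ih hq.2, mul_assoc]

theorem IsPath.snoc {u : V} {q : List A} {e : A} (hq : E.IsPath u q (E.src e)) :
    E.IsPath u (q ++ [e]) (E.rng e) :=
  E.isPath_append.2 ⟨_, hq, rfl, rfl⟩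

/-! ### The spanning set of the elements `pq*` -/

theorem mono_mem_gr {u v w : V} {p q : List A} (hp : E.IsPath u p w) (hq : E.IsPath v q w) :
    E.pathElt K u p * E.ghostElt K v q ∈ E.gr K ((p.length : ℤ) - q.length) :=
  Submodule.subset_span ⟨u, p, v, q, w, hp, hq, rfl, rfl⟩

theorem mono_mem_iSup_gr {u v w : V} {p q : List A} (hp : E.IsPath u p w)
    (hq : E.IsPath v q w) :
    E.pathElt K u p * E.ghostElt K v q ∈ ⨆ n, E.gr K n :=
  Submodule.mem_iSup_of_mem _ (mono_mem_gr hp hq)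

/-- A generator times pq* is 0 or again a monomial. The only case where q changes is a ghost edge
meeting a trivial p: it is then absorbed into q* as a new last edge of q. -/
theorem lgen_mul_mono_mem (g : Gen V A) {u v w : V} {p q : List A} (hp : E.IsPath u p w)
    (hq : E.IsPath v q w) :
    E.lgen K g * (E.pathElt K u p * E.ghostElt K v q) ∈ ⨆ n, E.gr K n := by
  cases g with
  | vtx x =>
    by_cases h : x = u
    · subst h
      rw [← mul_assoc, vtx_mul_pathElt K hp]
      exact mono_mem_iSup_gr hp hq
    · rw [← vtx_mul_pathElt K hp, ← mul_assoc, ← mul_assoc, vtx_mul_ne h, zero_mul, zero_mul]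
      exact zero_mem _
  | edge e =>
    by_cases h : E.rng e = u
    · subst h
      rw [← mul_assoc]
      exact mono_mem_iSup_gr (p := e :: p) (u := E.src e) ⟨rfl, hp⟩ hq
    · rw [← vtx_mul_pathElt K hp, ← edge_mul_rng, mul_assoc, ← mul_assoc 𝓋[_],
        ← mul_assoc 𝓋[_], vtx_mul_ne h, zero_mul, zero_mul, mul_zero]
      exact zero_mem _
  | ghost e =>
    cases p with
    | nil =>
      obtain rfl : u = w := hp
      rw [pathElt, vtx_mul_ghostElt K hq]
      by_cases h : E.src e = u
      · subst h
        rw [← ghostElt_snoc hq, ← vtx_mul_ghostElt K hq.snoc]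
        exact mono_mem_iSup_gr (p := []) (u := E.rng e) rfl hq.snoc
      · rw [← vtx_mul_ghostElt K hq, ← mul_assoc, ghost_mul_vtx_ne h, zero_mul]
        exact zero_mem _
    | cons f p =>
      rw [pathElt, mul_assoc, ← mul_assoc]
      by_cases h : e = f
      · subst h
        rw [ghost_mul_edge, ← mul_assoc, vtx_mul_pathElt K hp.2]
        exact mono_mem_iSup_gr hp.2 hq
      · rw [ghost_mul_edge_ne h, zero_mul]
        exact zero_mem _

theorem lgen_mem_iSup_gr (g : Gen V A) : E.lgen K g ∈ ⨆ n, E.gr K n := by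
  have hv : ∀ v, 𝓋[v] = E.pathElt K v [] * E.ghostElt K v [] := fun v =>
    (vtx_mul_self v).symm
  cases g with
  | vtx v =>
    rw [hv]
    exact mono_mem_iSup_gr (w := v) rfl rfl
  | edge e =>
    rw [← edge_mul_rng, hv]
    exact lgen_mul_mono_mem _ (w := E.rng e) rfl rfl
  | ghost e =>
    rw [← ghost_mul_src, hv]
    exact lgen_mul_mono_mem _ (w := E.src e) rfl rfl

/-- `L_K(E)` is the sum of its components. -/
theorem iSup_gr : ⨆ n, E.gr K n = ⊤ := by
  -- The second half, stability under left multiplication by x, is what makes the induction pass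
  -- through products.
  have key : ∀ (x : E.UnitalLPA K) (hx : x ∈ NonUnitalAlgebra.adjoin K (Set.range (E.gen K))),
      (⟨x, hx⟩ : E.LPA K) ∈ ⨆ n, E.gr K n ∧
        ∀ y ∈ ⨆ n, E.gr K n, (⟨x, hx⟩ : E.LPA K) * y ∈ ⨆ n, E.gr K n := by
    intro x hx
    induction hx using NonUnitalAlgebra.adjoin_induction with
    | mem x hx =>
      obtain ⟨g, rfl⟩ := hx
      refine ⟨lgen_mem_iSup_gr g, fun y hy => ?_⟩
      induction hy using Submodule.iSup_induction' with
      | zero => rw [mul_zero]; exact zero_mem _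
      | add y z _ _ hy hz => rw [mul_add]; exact add_mem hy hz
      | mem n y hy =>
        induction hy using Submodule.span_induction with
        | zero => rw [mul_zero]; exact zero_mem _
        | add y z _ _ hy hz => rw [mul_add]; exact add_mem hy hz
        | smul k y _ hy => rw [mul_smul_comm]; exact Submodule.smul_mem _ _ hy
        | mem y hy =>
          obtain ⟨u, p, v, q, w, hp, hq, -, rfl⟩ := hy
          exact lgen_mul_mono_mem g hp hq
    | zero => exact ⟨zero_mem _, fun y _ => by
        rw [show (⟨0, _⟩ : E.LPA K) = 0 from rfl, zero_mul]; exact zero_mem _⟩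
    | add x y hx hy ihx ihy =>
      rw [show (⟨x + y, _⟩ : E.LPA K) = ⟨x, hx⟩ + ⟨y, hy⟩ from rfl]
      exact ⟨add_mem ihx.1 ihy.1, fun z hz => by
        rw [add_mul]; exact add_mem (ihx.2 z hz) (ihy.2 z hz)⟩
    | mul x y hx hy ihx ihy =>
      rw [show (⟨x * y, _⟩ : E.LPA K) = ⟨x, hx⟩ * ⟨y, hy⟩ from rfl]
      exact ⟨ihx.2 _ ihy.1, fun z hz => by rw [mul_assoc]; exact ihx.2 _ (ihy.2 z hz)⟩
    | smul k x hx ihx =>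
      rw [show (⟨k • x, _⟩ : E.LPA K) = k • ⟨x, hx⟩ from rfl]
      exact ⟨Submodule.smul_mem _ _ ihx.1, fun z hz => by
        rw [smul_mul_assoc]; exact Submodule.smul_mem _ _ (ihx.2 z hz)⟩
  exact eq_top_iff.2 fun x _ => (key x.1 x.2).1

/-- Every element of `L_K(E)` is a sum of homogeneous elements. -/
theorem exists_sum_homogeneous (a : E.LPA K) :
    ∃ (s : Finset ℤ) (f : ℤ → E.LPA K), (∀ n, f n ∈ E.gr K n) ∧ a = ∑ n ∈ s, f n := by
  have ha : a ∈ ⨆ n, E.gr K n := iSup_gr (E := E) (K := K) ▸ Submodule.mem_top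
  obtain ⟨f, hf, rfl⟩ := (Submodule.mem_iSup_iff_exists_finsupp _ _).1 ha
  exact ⟨f.support, f, hf, rfl⟩

/-- Induction over the elements of a component of `L_K(E)`. -/
theorem gr_induction {n : ℤ} {C : E.LPA K → Prop} (zero : C 0)
    (add : ∀ a b, C a → C b → C (a + b))
    (mono : ∀ (k : K) u p v q w, E.IsPath u p w → E.IsPath v q w →
      (p.length : ℤ) - q.length = n → C (k • (E.pathElt K u p * E.ghostElt K v q)))
    {a : E.LPA K} (ha : a ∈ E.gr K n) : C a := by
  -- Scalars are attached to monomials only, so C need not be closed under scalars. This matters for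
  -- modules M that are mere abelian groups.
  induction ha using Submodule.closure_induction with
  | zero => exact zero
  | add x y _ _ hx hy => exact add x y hx hy
  | smul_mem k x hx =>
    obtain ⟨u, p, v, q, w, hp, hq, hn, rfl⟩ := hx
    exact mono k u p v q w hp hq hn

/-- Induction over the elements of `L_K(E)`. -/
theorem lpa_induction {C : E.LPA K → Prop} (zero : C 0)
    (add : ∀ a b, C a → C b → C (a + b))
    (mono : ∀ (k : K) u p v q w, E.IsPath u p w → E.IsPath v q w →
      C (k • (E.pathElt K u p * E.ghostElt K v q)))
    (a : E.LPA K) : C a := by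
  obtain ⟨s, f, hf, rfl⟩ := exists_sum_homogeneous a
  refine Finset.sum_induction _ C add zero fun n _ =>
    gr_induction zero add (fun k u p v q w hp hq _ => mono k u p v q w hp hq) (hf n)

/-! ### Gap elements -/

variable (E K) in
/-- The element `∑ ee*`, where `e` runs through a finite set of edges. -/
noncomputable def edgeProj (F : Finset A) : E.LPA K := ∑ e ∈ F, ℯ[e] * ℊ[e]

variable (E K) in
/-- The element `v - ∑ ee*`, where `e` runs through a finite set of edges. -/
noncomputable def gap (v : V) (F : Finset A) : E.LPA K := 𝓋[v] - E.edgeProj K F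

theorem ghost_mul_edgeProj {F : Finset A} {e : A} (he : e ∈ F) :
    ℊ[e] * E.edgeProj K F = ℊ[e] := by
  rw [edgeProj, Finset.mul_sum, Finset.sum_eq_single_of_mem e he, ← mul_assoc, ghost_mul_edge,
    rng_mul_ghost]
  intro f _ hf
  rw [← mul_assoc, ghost_mul_edge_ne hf.symm, zero_mul]

theorem ghost_mul_edgeProj_notMem {F : Finset A} {e : A} (he : e ∉ F) :
    ℊ[e] * E.edgeProj K F = 0 := by
  rw [edgeProj, Finset.mul_sum]
  refine Finset.sum_eq_zero fun f hf => ?_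
  rw [← mul_assoc, ghost_mul_edge_ne (ne_of_mem_of_not_mem hf he).symm, zero_mul]

theorem edgeProj_mul_edge {F : Finset A} {e : A} (he : e ∈ F) :
    E.edgeProj K F * ℯ[e] = ℯ[e] := by
  rw [edgeProj, Finset.sum_mul, Finset.sum_eq_single_of_mem e he, mul_assoc, ghost_mul_edge,
    edge_mul_rng]
  intro f _ hf
  rw [mul_assoc, ghost_mul_edge_ne hf, mul_zero]

theorem edgeProj_mul_edge_notMem {F : Finset A} {e : A} (he : e ∉ F) :
    E.edgeProj K F * ℯ[e] = 0 := by
  rw [edgeProj, Finset.sum_mul]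
  refine Finset.sum_eq_zero fun f hf => ?_
  rw [mul_assoc, ghost_mul_edge_ne (ne_of_mem_of_not_mem hf he), mul_zero]

theorem edgeProj_mul_of_subset {F G : Finset A} (h : F ⊆ G) :
    E.edgeProj K G * E.edgeProj K F = E.edgeProj K F := by
  conv_lhs => rw [edgeProj, edgeProj, Finset.mul_sum]
  rw [edgeProj]
  refine Finset.sum_congr rfl fun e he => ?_
  rw [← mul_assoc]
  exact congrArg (· * _) (edgeProj_mul_edge (h he))

theorem edgeProj_mul_of_superset {F G : Finset A} (h : F ⊆ G) :
    E.edgeProj K F * E.edgeProj K G = E.edgeProj K F := by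
  conv_lhs => rw [edgeProj, edgeProj, Finset.sum_mul]
  rw [edgeProj]
  refine Finset.sum_congr rfl fun e he => ?_
  rw [mul_assoc]
  exact congrArg (_ * ·) (ghost_mul_edgeProj (h he))

open Classical in
theorem vtx_mul_edgeProj (v : V) (F : Finset A) :
    𝓋[v] * E.edgeProj K F = E.edgeProj K (F.filter (E.src · = v)) := by
  rw [edgeProj, edgeProj, Finset.mul_sum, Finset.sum_filter]
  refine Finset.sum_congr rfl fun e _ => ?_
  split_ifs with h
  · rw [← h, ← mul_assoc, src_mul_edge]
  · rw [← mul_assoc, vtx_mul_edge_ne (Ne.symm h), zero_mul]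

open Classical in
theorem edgeProj_mul_vtx (v : V) (F : Finset A) :
    E.edgeProj K F * 𝓋[v] = E.edgeProj K (F.filter (E.src · = v)) := by
  rw [edgeProj, edgeProj, Finset.sum_mul, Finset.sum_filter]
  refine Finset.sum_congr rfl fun e _ => ?_
  split_ifs with h
  · rw [← h, mul_assoc, ghost_mul_src]
  · rw [mul_assoc, ghost_mul_vtx_ne h, mul_zero]

theorem vtx_mul_gap {v : V} {F : Finset A} (hF : ∀ e ∈ F, E.src e = v) :
    𝓋[v] * E.gap K v F = E.gap K v F := by
  classical
  rw [gap, lpa_mul_sub, vtx_mul_self, vtx_mul_edgeProj, Finset.filter_true_of_mem hF]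

theorem ghost_mul_gap_mem {v : V} {F : Finset A} (hF : ∀ e ∈ F, E.src e = v) {e : A}
    (he : e ∈ F) : ℊ[e] * E.gap K v F = 0 := by
  rw [gap, lpa_mul_sub, ghost_mul_edgeProj he, ← hF e he, ghost_mul_src, lpa_sub_self]

theorem ghost_mul_gap_notMem {v : V} {F : Finset A} {e : A} (hv : E.src e = v)
    (he : e ∉ F) : ℊ[e] * E.gap K v F = ℊ[e] := by
  rw [gap, lpa_mul_sub, ghost_mul_edgeProj_notMem he, ← hv, ghost_mul_src, lpa_sub_zero]

theorem gap_mul_edge_mem {v : V} {F : Finset A} (hF : ∀ e ∈ F, E.src e = v) {e : A}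
    (he : e ∈ F) : E.gap K v F * ℯ[e] = 0 := by
  rw [gap, lpa_sub_mul, edgeProj_mul_edge he, ← hF e he, src_mul_edge, lpa_sub_self]

theorem gap_mul_edge_notMem {v : V} {F : Finset A} {e : A} (hv : E.src e = v)
    (he : e ∉ F) : E.gap K v F * ℯ[e] = ℯ[e] := by
  rw [gap, lpa_sub_mul, edgeProj_mul_edge_notMem he, ← hv, src_mul_edge, lpa_sub_zero]

/-! ### Graded ideals are determined by their gap elements -/

variable (E K) in
/-- The span of the elements `pq*` of degree `n` with `|p| + |q| < N`. -/
def grLT (N : ℕ) (n : ℤ) : Submodule K (E.LPA K) :=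
  Submodule.span K {x | ∃ u p v q w, E.IsPath u p w ∧ E.IsPath v q w ∧
    (p.length : ℤ) - q.length = n ∧ p.length + q.length < N ∧
    x = E.pathElt K u p * E.ghostElt K v q}

theorem grLT_mono {M N : ℕ} (h : M ≤ N) (n : ℤ) : E.grLT K M n ≤ E.grLT K N n :=
  Submodule.span_mono fun _ ⟨u, p, v, q, w, hp, hq, hn, hN, hx⟩ =>
    ⟨u, p, v, q, w, hp, hq, hn, hN.trans_le h, hx⟩

theorem exists_mem_grLT {n : ℤ} {a : E.LPA K} (ha : a ∈ E.gr K n) : ∃ N, a ∈ E.grLT K N n := by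
  induction ha using Submodule.span_induction with
  | mem x hx =>
    obtain ⟨u, p, v, q, w, hp, hq, hn, rfl⟩ := hx
    exact ⟨p.length + q.length + 1, Submodule.subset_span
      ⟨u, p, v, q, w, hp, hq, hn, Nat.lt_succ_self _, rfl⟩⟩
  | zero => exact ⟨0, zero_mem _⟩
  | add x y _ _ hx hy =>
    obtain ⟨M, hM⟩ := hx
    obtain ⟨N, hN⟩ := hy
    exact ⟨max M N, add_mem (grLT_mono (le_max_left _ _) n hM) (grLT_mono (le_max_right _ _) n hN)⟩
  | smul k x _ hx =>
    obtain ⟨N, hN⟩ := hx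
    exact ⟨N, Submodule.smul_mem _ _ hN⟩

theorem edgeProj_mul_eq_of_subset {F G : Finset A} (h : F ⊆ G) {a : E.LPA K}
    (ha : E.edgeProj K F * a = a) : E.edgeProj K G * a = a := by
  rw [← ha, ← mul_assoc, edgeProj_mul_of_subset h]

theorem mul_edgeProj_eq_of_subset {F G : Finset A} (h : F ⊆ G) {a : E.LPA K}
    (ha : a * E.edgeProj K F = a) : a * E.edgeProj K G = a := by
  rw [← ha, mul_assoc, edgeProj_mul_of_superset h]

/-- In positive degree every monomial pq* has nontrivial p. Collecting the first edges into F writes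
a as a sum of the e(e*a), whose inner factors involve shorter monomials. -/
theorem exists_of_mem_grLT_pos {N : ℕ} {n : ℤ} (hn : 0 < n) {a : E.LPA K}
    (ha : a ∈ E.grLT K (N + 1) n) :
    (∃ F, E.edgeProj K F * a = a) ∧ ∀ e, ℊ[e] * a ∈ E.grLT K N (n - 1) := by
  classical
  induction ha using Submodule.span_induction with
  | mem x hx =>
    obtain ⟨u, p, v, q, w, hp, hq, hpq, hN, rfl⟩ := hx
    cases p with
    | nil => simp at hpq; omega
    | cons f p =>
      refine ⟨⟨{f}, ?_⟩, fun e => ?_⟩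
      · rw [pathElt, ← mul_assoc, ← mul_assoc, edgeProj_mul_edge (by simp)]
      · rw [pathElt, ← mul_assoc, ← mul_assoc]
        by_cases h : e = f
        · subst h
          rw [ghost_mul_edge, vtx_mul_pathElt K hp.2]
          refine Submodule.subset_span ⟨_, p, v, q, w, hp.2, hq, ?_, ?_, rfl⟩
          · rw [← hpq, List.length_cons]
            push_cast
            ring
          · rw [List.length_cons] at hN
            omega
        · rw [ghost_mul_edge_ne h, zero_mul, zero_mul]
          exact zero_mem _
  | zero => exact ⟨⟨∅, mul_zero _⟩, fun e => by rw [mul_zero]; exact zero_mem _⟩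
  | add x y _ _ hx hy =>
    obtain ⟨⟨F, hF⟩, hx⟩ := hx
    obtain ⟨⟨G, hG⟩, hy⟩ := hy
    refine ⟨⟨F ∪ G, ?_⟩, fun e => ?_⟩
    · rw [mul_add, edgeProj_mul_eq_of_subset Finset.subset_union_left hF,
        edgeProj_mul_eq_of_subset Finset.subset_union_right hG]
    · rw [mul_add]
      exact add_mem (hx e) (hy e)
  | smul k x _ hx =>
    obtain ⟨⟨F, hF⟩, hx⟩ := hx
    exact ⟨⟨F, by rw [mul_smul_comm, hF]⟩, fun e => by
      rw [mul_smul_comm]; exact Submodule.smul_mem _ _ (hx e)⟩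

theorem exists_of_mem_grLT_neg {N : ℕ} {n : ℤ} (hn : n < 0) {a : E.LPA K}
    (ha : a ∈ E.grLT K (N + 1) n) :
    (∃ F, a * E.edgeProj K F = a) ∧ ∀ e, a * ℯ[e] ∈ E.grLT K N (n + 1) := by
  classical
  induction ha using Submodule.span_induction with
  | mem x hx =>
    obtain ⟨u, p, v, q, w, hp, hq, hpq, hN, rfl⟩ := hx
    cases q with
    | nil => simp at hpq; omega
    | cons f q =>
      refine ⟨⟨{f}, ?_⟩, fun e => ?_⟩
      · rw [ghostElt, mul_assoc, mul_assoc, ghost_mul_edgeProj (by simp)]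
      · rw [ghostElt, mul_assoc, mul_assoc]
        by_cases h : f = e
        · subst h
          rw [ghost_mul_edge, ghostElt_mul_vtx K hq.2]
          refine Submodule.subset_span ⟨u, p, _, q, w, hp, hq.2, ?_, ?_, rfl⟩
          · rw [← hpq, List.length_cons]
            push_cast
            ring
          · rw [List.length_cons] at hN
            omega
        · rw [ghost_mul_edge_ne h, mul_zero, mul_zero]
          exact zero_mem _
  | zero => exact ⟨⟨∅, zero_mul _⟩, fun e => by rw [zero_mul]; exact zero_mem _⟩
  | add x y _ _ hx hy =>
    obtain ⟨⟨F, hF⟩, hx⟩ := hx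
    obtain ⟨⟨G, hG⟩, hy⟩ := hy
    refine ⟨⟨F ∪ G, ?_⟩, fun e => ?_⟩
    · rw [add_mul, mul_edgeProj_eq_of_subset Finset.subset_union_left hF,
        mul_edgeProj_eq_of_subset Finset.subset_union_right hG]
    · rw [add_mul]
      exact add_mem (hx e) (hy e)
  | smul k x _ hx =>
    obtain ⟨⟨F, hF⟩, hx⟩ := hx
    exact ⟨⟨F, by rw [smul_mul_assoc, hF]⟩, fun e => by
      rw [smul_mul_assoc]; exact Submodule.smul_mem _ _ (hx e)⟩

theorem vtx_mem_grLT {N : ℕ} (hN : 0 < N) (v : V) : 𝓋[v] ∈ E.grLT K N 0 :=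
  Submodule.subset_span ⟨v, [], v, [], v, rfl, rfl, rfl, hN, (vtx_mul_self v).symm⟩

theorem ghost_mul_vtx_mul_edge_mem {N : ℕ} (hN : 0 < N) (v : V) (e f : A) :
    ℊ[e] * 𝓋[v] * ℯ[f] ∈ E.grLT K N 0 := by
  by_cases h : E.src e = v
  · rw [← h, ghost_mul_src]
    by_cases hef : e = f
    · rw [hef, ghost_mul_edge]
      exact vtx_mem_grLT hN _
    · rw [ghost_mul_edge_ne hef]
      exact zero_mem _
  · rw [ghost_mul_vtx_ne h, zero_mul]
    exact zero_mem _

/-- In degree 0 either p and q are both trivial, giving the vertex part, or both have positive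
length, giving b; F collects their first edges. The last clause ensures that vertices, of total
length 0, already lie in `grLT` at level N whenever there is an edge to strip. -/
theorem exists_of_mem_grLT_zero {N : ℕ} {a : E.LPA K} (ha : a ∈ E.grLT K (N + 1) 0) :
    ∃ (k : V →₀ K) (b : E.LPA K) (F : Finset A), a = (k.sum fun u c => c • 𝓋[u]) + b ∧
      E.edgeProj K F * b = b ∧ b * E.edgeProj K F = b ∧
      (∀ e f, ℊ[e] * b * ℯ[f] ∈ E.grLT K N 0) ∧ (F.Nonempty → 0 < N) := by
  classical
  induction ha using Submodule.closure_induction with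
  | zero =>
    refine ⟨0, 0, ∅, by simp, mul_zero _, zero_mul _, fun e f => ?_, by simp⟩
    rw [mul_zero, zero_mul]
    exact zero_mem _
  | add x y _ _ hx hy =>
    obtain ⟨k, b, F, rfl, h₁, h₂, h₃, h₄⟩ := hx
    obtain ⟨l, c, G, rfl, g₁, g₂, g₃, g₄⟩ := hy
    refine ⟨k + l, b + c, F ∪ G, ?_, ?_, ?_, fun e f => ?_, ?_⟩
    · rw [Finsupp.sum_add_index' (h := fun u (c : K) => c • 𝓋[u]) (fun _ => zero_smul _ _)
        (fun _ _ _ => add_smul _ _ _)]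
      abel
    · rw [mul_add, edgeProj_mul_eq_of_subset Finset.subset_union_left h₁,
        edgeProj_mul_eq_of_subset Finset.subset_union_right g₁]
    · rw [add_mul, mul_edgeProj_eq_of_subset Finset.subset_union_left h₂,
        mul_edgeProj_eq_of_subset Finset.subset_union_right g₂]
    · rw [mul_add, add_mul]
      exact add_mem (h₃ e f) (g₃ e f)
    · rw [Finset.union_nonempty]
      rintro (h | h)
      exacts [h₄ h, g₄ h]
  | smul_mem k x hx =>
    obtain ⟨u, p, v, q, w, hp, hq, hpq, hN, rfl⟩ := hx
    cases p with
    | nil =>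
      cases q with
      | cons f q => simp at hpq; omega
      | nil =>
        obtain rfl : u = w := hp
        obtain rfl : v = u := hq
        refine ⟨Finsupp.single v k, 0, ∅, ?_, mul_zero _, zero_mul _, fun e f => ?_, by simp⟩
        · rw [Finsupp.sum_single_index (h := fun u (c : K) => c • 𝓋[u]) (zero_smul _ _), add_zero,
             pathElt, ghostElt, vtx_mul_self]
        · rw [mul_zero, zero_mul]
          exact zero_mem _
    | cons e' p =>
      cases q with
      | nil => simp at hpq; omega
      | cons f' q =>
        have hN' : p.length + q.length < N := by
          simp only [List.length_cons] at hN
          omega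
        refine ⟨0, k • (E.pathElt K u (e' :: p) * E.ghostElt K v (f' :: q)), {e', f'},
          by simp, ?_, ?_, fun e f => ?_, fun _ => by omega⟩
        · rw [mul_smul_comm, pathElt, ← mul_assoc, ← mul_assoc, edgeProj_mul_edge (by simp)]
        · rw [smul_mul_assoc, ghostElt, mul_assoc, mul_assoc, ghost_mul_edgeProj (by simp)]
        · rw [mul_smul_comm, smul_mul_assoc]
          refine Submodule.smul_mem _ _ ?_
          rw [pathElt, ghostElt]
          rw [show ℊ[e] * (ℯ[e'] * E.pathElt K (E.rng e') p *
            (E.ghostElt K (E.rng f') q * ℊ[f'])) * ℯ[f] = (ℊ[e] * ℯ[e']) *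
            E.pathElt K (E.rng e') p * (E.ghostElt K (E.rng f') q * (ℊ[f'] * ℯ[f])) by
              simp only [mul_assoc]]
          by_cases he : e = e'
          · by_cases hf : f' = f
            · rw [he, hf, ghost_mul_edge, ghost_mul_edge, vtx_mul_pathElt K hp.2, ← hf,
                ghostElt_mul_vtx K hq.2]
              refine Submodule.subset_span ⟨_, p, _, q, w, hp.2, hq.2, ?_, hN', rfl⟩
              simpa using hpq
            · rw [ghost_mul_edge_ne hf, mul_zero, mul_zero]
              exact zero_mem _
          · rw [ghost_mul_edge_ne he, zero_mul, zero_mul]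
            exact zero_mem _

section

variable {R S : Type*} [NonUnitalNonAssocRing R] [NonUnitalNonAssocRing S]

/-- The kernel of a homomorphism is a graded ideal. -/
def KerGraded (φ : E.LPA K →ₙ+* R) : Prop :=
  ∀ (s : Finset ℤ) (f : ℤ → E.LPA K), (∀ n, f n ∈ E.gr K n) → φ (∑ n ∈ s, f n) = 0 →
    ∀ n ∈ s, φ (f n) = 0

open Classical in
theorem vtx_eq_gap_add (u : V) (F : Finset A) :
    𝓋[u] = E.gap K u (F.filter (E.src · = u)) + E.edgeProj K F * 𝓋[u] * E.edgeProj K F := by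
  rw [edgeProj_mul_vtx, edgeProj_mul_of_superset (Finset.filter_subset _ _), gap]
  exact (sub_add_cancel 𝓋[u] _).symm

/-- Induction on the length bound. In nonzero degree an edge or a ghost edge is stripped from one
side. In degree 0 the element splits into a combination of gap elements at distinct vertices and a
part sandwiched between edge projections; stripping on both sides shortens the latter. -/
theorem map_eq_zero_of_mem_grLT (φ : E.LPA K →ₙ+* R) (ψ : E.LPA K →ₙ+* S)
    (h : ∀ v (F : Finset A), (∀ e ∈ F, E.src e = v) →
      φ (E.gap K v F) = 0 → ψ (E.gap K v F) = 0)
    (N : ℕ) (n : ℤ) (a : E.LPA K) (ha : a ∈ E.grLT K N n) (hφ : φ a = 0) : ψ a = 0 := by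
  classical
  induction N generalizing n a with
  | zero =>
    have : a = 0 := by simpa [grLT] using ha
    rw [this, map_zero]
  | succ N ih =>
    rcases lt_trichotomy n 0 with hn | rfl | hn
    · obtain ⟨⟨F, hF⟩, hmem⟩ := exists_of_mem_grLT_neg hn ha
      rw [← hF, edgeProj, Finset.mul_sum, map_sum]
      refine Finset.sum_eq_zero fun e _ => ?_
      rw [← mul_assoc, map_mul, ih _ _ (hmem e) (by rw [map_mul, hφ, zero_mul]), zero_mul]
    · obtain ⟨k, b, F, hab, h₁, h₂, h₃, h₄⟩ := exists_of_mem_grLT_zero ha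
      set s := E.edgeProj K F with hs
      set g : V → E.LPA K := fun u => E.gap K u (F.filter (E.src · = u)) with hg
      have hgmul : ∀ u, 𝓋[u] * g u = g u := fun u => vtx_mul_gap (by simp)
      have hgne : ∀ u w, u ≠ w → 𝓋[u] * g w = 0 := fun u w huw => by
        rw [← hgmul w, ← mul_assoc, vtx_mul_ne huw, zero_mul]
      -- Each vertex u is the gap element `g u` plus sus, and b = sbs.
      have hdec : a = (k.sum fun u c => c • g u) + s * a * s := by
        have hk : (k.sum fun u c => c • 𝓋[u]) =
            (k.sum fun u c => c • g u) + s * (k.sum fun u c => c • 𝓋[u]) * s := by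
          rw [Finsupp.sum, Finsupp.sum, Finset.mul_sum, Finset.sum_mul,
            ← Finset.sum_add_distrib]
          refine Finset.sum_congr rfl fun u _ => ?_
          rw [mul_smul_comm, smul_mul_assoc, ← smul_add]
          congr 1
          exact vtx_eq_gap_add u F
        conv_lhs => rw [hab, hk]
        rw [hab, mul_add, add_mul, h₁, h₂, add_assoc]
      have hsas : ψ (s * a * s) = 0 := by
        rw [hs, edgeProj, Finset.sum_mul, Finset.sum_mul, map_sum]
        refine Finset.sum_eq_zero fun e he => ?_
        rw [Finset.mul_sum, map_sum]
        refine Finset.sum_eq_zero fun f _ => ?_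
        have hmem : ℊ[e] * a * ℯ[f] ∈ E.grLT K N 0 := by
          rw [hab, mul_add, add_mul, Finsupp.sum, Finset.mul_sum, Finset.sum_mul]
          refine add_mem (Submodule.sum_mem _ fun u _ => ?_) (h₃ e f)
          rw [mul_smul_comm, smul_mul_assoc]
          exact Submodule.smul_mem _ _ (ghost_mul_vtx_mul_edge_mem (h₄ ⟨e, he⟩) u e f)
        rw [show ℯ[e] * ℊ[e] * a * (ℯ[f] * ℊ[f]) = ℯ[e] * (ℊ[e] * a * ℯ[f]) * ℊ[f] by
          simp only [mul_assoc], map_mul, map_mul,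
          ih _ _ hmem (by rw [map_mul, map_mul, hφ, mul_zero, zero_mul]), mul_zero, zero_mul]
      have hsas' : φ (s * a * s) = 0 := by rw [map_mul, map_mul, hφ, mul_zero, zero_mul]
      have hsum : φ (k.sum fun u c => c • g u) = 0 := by
        have := hφ
        rwa [hdec, map_add, hsas', add_zero] at this
      rw [hdec, map_add, hsas, add_zero, Finsupp.sum, map_sum]
      refine Finset.sum_eq_zero fun u hu => ?_
      have hku : k u ≠ 0 := Finsupp.mem_support_iff.1 hu
      have hgu : φ (g u) = 0 := by
        -- Left multiplication by u isolates the summand at u, so each gap element lies in the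
        -- kernel separately.
        have : g u = ((k u)⁻¹ • 𝓋[u]) * k.sum fun u c => c • g u := by
          rw [Finsupp.sum, Finset.mul_sum, Finset.sum_eq_single_of_mem u hu, smul_mul_assoc,
            mul_smul_comm, smul_smul, inv_mul_cancel₀ hku, one_smul, hgmul]
          intro w _ hw
          rw [smul_mul_assoc, mul_smul_comm, hgne u w hw.symm, smul_zero, smul_zero]
        rw [this, map_mul, hsum, mul_zero]
      rw [← hgmul u, ← smul_mul_assoc, map_mul, h u _ (by simp) hgu, mul_zero]
    · obtain ⟨⟨F, hF⟩, hmem⟩ := exists_of_mem_grLT_pos hn ha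
      rw [← hF, edgeProj, Finset.sum_mul, map_sum]
      refine Finset.sum_eq_zero fun e _ => ?_
      rw [mul_assoc, map_mul, ih _ _ (hmem e) (by rw [map_mul, hφ, mul_zero]), mul_zero]

theorem map_eq_zero_of_gap {φ : E.LPA K →ₙ+* R} (hφ : KerGraded φ) (ψ : E.LPA K →ₙ+* S)
    (h : ∀ v (F : Finset A), (∀ e ∈ F, E.src e = v) →
      φ (E.gap K v F) = 0 → ψ (E.gap K v F) = 0)
    {a : E.LPA K} (ha : φ a = 0) : ψ a = 0 := by
  obtain ⟨s, f, hf, rfl⟩ := exists_sum_homogeneous a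
  rw [map_sum]
  refine Finset.sum_eq_zero fun n hn => ?_
  obtain ⟨N, hN⟩ := exists_mem_grLT (hf n)
  exact map_eq_zero_of_mem_grLT φ ψ h N n _ hN (hφ s f hf ha n hn)

/-! ### The vertices and the gap vertices of a kernel -/

/-- The vertices outside the kernel of `φ`. -/
def support (φ : E.LPA K →ₙ+* R) : Set V := {v | φ 𝓋[v] ≠ 0}

variable (E) in
/-- The edges from `v` to the set `W`. -/
def outTo (W : Set V) (v : V) : Set A := {e | E.src e = v ∧ E.rng e ∈ W}

/-- The vertices `v` such that `v - ∑ ee*` is defined and not in the kernel of `φ`, where the sum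
is over the edges `e` from `v` to the support of `φ`. -/
def gapVerts (φ : E.LPA K →ₙ+* R) : Set V :=
  {v | ∃ F : Finset A, (F : Set A) = E.outTo (support φ) v ∧ φ (E.gap K v F) ≠ 0}

theorem mem_support {φ : E.LPA K →ₙ+* R} {v : V} : v ∈ support φ ↔ φ 𝓋[v] ≠ 0 := Iff.rfl

theorem map_edge_eq_zero {φ : E.LPA K →ₙ+* R} {e : A} (h : E.rng e ∉ support φ) :
    φ ℯ[e] = 0 := by
  rw [← edge_mul_rng, map_mul, not_not.1 h, mul_zero]

theorem map_ghost_eq_zero {φ : E.LPA K →ₙ+* R} {e : A} (h : E.rng e ∉ support φ) :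
    φ ℊ[e] = 0 := by
  rw [← rng_mul_ghost, map_mul, not_not.1 h, zero_mul]

theorem src_mem_support {φ : E.LPA K →ₙ+* R} {e : A} (h : E.rng e ∈ support φ) :
    E.src e ∈ support φ := by
  intro h'
  apply h
  rw [← ghost_mul_edge, ← src_mul_edge, map_mul, map_mul, h', zero_mul, mul_zero]

theorem mem_support_of_isPath {φ : E.LPA K →ₙ+* R} {u v : V} {p : List A} (hp : E.IsPath u p v)
    (hv : v ∈ support φ) : u ∈ support φ := by
  induction p generalizing u with
  | nil => exact (show u = v from hp) ▸ hv
  | cons e p ih => exact hp.1 ▸ src_mem_support (ih hp.2)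

theorem mem_support_of_reaches {φ : E.LPA K →ₙ+* R} {u v : V} (h : E.Reaches u v)
    (hv : v ∈ support φ) : u ∈ support φ :=
  mem_support_of_isPath h.choose_spec hv

theorem map_gap_eq_of_outTo_subset {φ : E.LPA K →ₙ+* R} {v : V} {F G : Finset A}
    (hG : ∀ e ∈ G, E.src e = v) (hF : (F : Set A) = E.outTo (support φ) v) (hFG : F ⊆ G) :
    φ (E.gap K v G) = φ (E.gap K v F) := by
  rw [gap, gap, lpa_map_sub, lpa_map_sub, edgeProj, edgeProj, map_sum, map_sum]
  congr 1
  refine (Finset.sum_subset hFG fun e he he' => ?_).symm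
  have : E.rng e ∉ support φ := fun h => he' (by
    rw [← Finset.mem_coe, hF]
    exact ⟨hG e he, h⟩)
  rw [map_mul, map_edge_eq_zero this, zero_mul]

/-- For an edge e at v outside G, e*(v - ∑ ff*)e = r(e), so a vanishing gap element forces G to
contain all edges into the support. The other edges of G are killed by φ, and what remains is the
gap element that defines `gapVerts`. -/
theorem map_gap_eq_zero_iff {φ : E.LPA K →ₙ+* R} {v : V} {G : Finset A}
    (hG : ∀ e ∈ G, E.src e = v) :
    φ (E.gap K v G) = 0 ↔ E.outTo (support φ) v ⊆ G ∧ v ∉ gapVerts φ := by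
  classical
  constructor
  · intro h
    have hsub : E.outTo (support φ) v ⊆ G := by
      rintro e ⟨hev, he⟩
      by_contra heG
      apply he
      rw [← ghost_mul_edge, ← gap_mul_edge_notMem (F := G) hev heG, map_mul, map_mul, h, zero_mul,
        mul_zero]
    refine ⟨hsub, ?_⟩
    rintro ⟨F, hF, hne⟩
    exact hne (by
      rw [← map_gap_eq_of_outTo_subset hG hF (Finset.coe_subset.1 (hF ▸ hsub)), h])
  · rintro ⟨hsub, hv⟩
    have hfin : (E.outTo (support φ) v).Finite := G.finite_toSet.subset hsub
    have hF : (hfin.toFinset : Set A) = E.outTo (support φ) v := by simp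
    rw [map_gap_eq_of_outTo_subset hG hF (Finset.coe_subset.1 (hF.subset.trans hsub))]
    by_contra hne
    exact hv ⟨_, hF, hne⟩

/-- Graded ideals are determined by the vertices and the gap vertices. -/
theorem map_eq_zero_iff_of_support_eq {φ : E.LPA K →ₙ+* R} {ψ : E.LPA K →ₙ+* S}
    (hφ : KerGraded φ) (hψ : KerGraded ψ) (hs : support φ = support ψ)
    (hg : gapVerts φ = gapVerts ψ) (a : E.LPA K) : φ a = 0 ↔ ψ a = 0 := by
  constructor
  · refine map_eq_zero_of_gap hφ ψ fun v F hF => ?_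
    rw [map_gap_eq_zero_iff hF, map_gap_eq_zero_iff hF, hs, hg]
    exact id
  · refine map_eq_zero_of_gap hψ φ fun v F hF => ?_
    rw [map_gap_eq_zero_iff hF, map_gap_eq_zero_iff hF, hs, hg]
    exact id

/-- Without edges into the support the gap element is v itself, an empty sum being subtracted. -/
theorem outTo_nonempty {φ : E.LPA K →ₙ+* R} {v : V} (hv : v ∈ support φ)
    (hg : v ∉ gapVerts φ) : (E.outTo (support φ) v).Nonempty := by
  rw [Set.nonempty_iff_ne_empty]
  intro h
  refine hg ⟨∅, by simp [h], ?_⟩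
  rw [gap, edgeProj, Finset.sum_empty, lpa_sub_zero]
  exact hv

theorem gapVerts_subset_support {φ : E.LPA K →ₙ+* R} : gapVerts φ ⊆ support φ := by
  rintro v ⟨F, hF, hne⟩ h
  apply hne
  rw [← vtx_mul_gap (fun e he => ((Set.ext_iff.1 hF e).1 he).1), map_mul, h, zero_mul]

/-- At a regular vertex the gap element over all emitted edges is 0 by (CK2). Hence `repN` is
defined at every gap vertex. -/
theorem not_isRegular_of_mem_gapVerts {φ : E.LPA K →ₙ+* R} {v : V} (h : v ∈ gapVerts φ) :
    ¬ E.IsRegular v := by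
  rintro ⟨h₁, h₂⟩
  have hfin : (E.out v).Finite := Set.not_infinite.1 h₂
  have hne : (E.out v).Nonempty := Set.nonempty_iff_ne_empty.2 h₁
  have h0 : φ (E.gap K v hfin.toFinset) = 0 := by
    rw [gap, edgeProj, ← vtx_eq_sum v hfin hne, lpa_sub_self, map_zero]
  exact ((map_gap_eq_zero_iff (by simp [out])).1 h0).2 h

end

/-! ### Reachability -/

theorem Reaches.refl (v : V) : E.Reaches v v := ⟨[], rfl⟩

theorem Reaches.trans {u v w : V} (h : E.Reaches u v) (h' : E.Reaches v w) : E.Reaches u w := by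
  obtain ⟨p, hp⟩ := h
  obtain ⟨q, hq⟩ := h'
  exact ⟨p ++ q, E.isPath_append.2 ⟨v, hp, hq⟩⟩

theorem reaches_rng (e : A) : E.Reaches (E.src e) (E.rng e) := ⟨[e], rfl, rfl⟩

/-! ### Graded simple modules -/

section

variable {M : Type*} [AddCommGroup M]

theorem rep_mul_apply (ρ : E.LPA K →ₙ+* AddMonoid.End M) (a b : E.LPA K) (m : M) :
    ρ (a * b) m = ρ a (ρ b m) := by
  rw [map_mul]
  rfl

theorem rep_add_apply (ρ : E.LPA K →ₙ+* AddMonoid.End M) (a b : E.LPA K) (m : M) :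
    ρ (a + b) m = ρ a m + ρ b m := by
  rw [map_add]
  rfl

theorem rep_zero_apply (ρ : E.LPA K →ₙ+* AddMonoid.End M) (m : M) : ρ 0 m = 0 := by
  rw [map_zero]
  rfl

theorem rep_sum_apply (ρ : E.LPA K →ₙ+* AddMonoid.End M) {ι : Type*} (s : Finset ι)
    (f : ι → E.LPA K) (m : M) : ρ (∑ i ∈ s, f i) m = ∑ i ∈ s, ρ (f i) m := by
  rw [map_sum]
  exact AddMonoidHom.finsetSum_apply _ _ _

theorem rep_ne_zero {ρ : E.LPA K →ₙ+* AddMonoid.End M} {a : E.LPA K} {m : M}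
    (h : ρ a m ≠ 0) : ρ a ≠ 0 := fun h' => h (by rw [h']; rfl)

theorem mem_ann {ρ : E.LPA K →ₙ+* AddMonoid.End M} {a : E.LPA K} :
    a ∈ ann ρ ↔ ρ a = 0 :=
  ⟨fun h => AddMonoidHom.ext h, fun h m => by rw [h]; rfl⟩

variable {ρ : E.LPA K →ₙ+* AddMonoid.End M} {ℳ : ℤ → AddSubgroup M} [DirectSum.Decomposition ℳ]

theorem exists_homogeneous {a : E.LPA K} (h : ρ a ≠ 0) : ∃ j, ∃ y ∈ ℳ j, ρ a y ≠ 0 := by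
  by_contra! hcon
  apply h
  refine mem_ann.1 fun m => ?_
  induction m using DirectSum.Decomposition.inductionOn ℳ with
  | zero => rw [map_zero]
  | homogeneous m => exact hcon _ _ m.2
  | add m m' hm hm' => rw [map_add, hm, hm', add_zero]

/-- The components of a send a homogeneous vector to different degrees, so their contributions
cannot cancel. -/
theorem IsGradedSimple.kerGraded (hM : IsGradedSimple ρ ℳ) : KerGraded ρ := by
  intro s f hf h0 n hn
  by_contra hne
  obtain ⟨j, y, hy, hne⟩ := exists_homogeneous (ℳ := ℳ) hne
  apply hne
  have h : (DirectSum.decompose ℳ (∑ i ∈ s, ρ (f i) y) (n + j) : M) = 0 := by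
    rw [← rep_sum_apply, h0]
    simp
  rw [DirectSum.decompose_sum, DFinsupp.finsetSum_apply, AddSubmonoidClass.coe_finsetSum,
    Finset.sum_eq_single_of_mem n hn,
    DirectSum.decompose_of_mem_same ℳ (hM.graded _ _ _ (hf n) _ hy)] at h
  · exact h
  · intro i _ hi
    rw [DirectSum.decompose_of_mem_ne ℳ (hM.graded _ _ _ (hf i) _ hy)]
    omega

/-- The submodule Lx is graded because x is homogeneous. As L has no unit in general, Lx ≠ 0 must be
supplied by b. -/
theorem IsGradedSimple.exists_rep_eq (hM : IsGradedSimple ρ ℳ) {j : ℤ} {x : M} (hx : x ∈ ℳ j)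
    {b : E.LPA K} (hb : ρ b x ≠ 0) (y : M) : ∃ a, ρ a x = y := by
  let N : AddSubgroup M :=
    { carrier := {y | ∃ a, ρ a x = y}
      zero_mem' := ⟨0, rep_zero_apply ρ x⟩
      add_mem' := by
        rintro _ _ ⟨a, rfl⟩ ⟨b, rfl⟩
        exact ⟨a + b, rep_add_apply ρ a b x⟩
      neg_mem' := by
        rintro _ ⟨a, rfl⟩
        refine ⟨-a, ?_⟩
        have : ρ (-a) = -ρ a := map_neg ρ a
        rw [this]
        rfl }
  have hN := hM.simple N
    (by
      rintro a _ ⟨b, rfl⟩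
      exact ⟨a * b, rep_mul_apply ρ a b x⟩)
    (by
      rintro _ ⟨a, rfl⟩ i
      obtain ⟨s, f, hf, rfl⟩ := exists_sum_homogeneous a
      rw [rep_sum_apply, DirectSum.decompose_sum, DFinsupp.finsetSum_apply,
        AddSubmonoidClass.coe_finsetSum]
      refine sum_mem fun n _ => ?_
      by_cases h : n + j = i
      · rw [← h, DirectSum.decompose_of_mem_same ℳ (hM.graded _ _ _ (hf n) _ hx)]
        exact ⟨_, rfl⟩
      · rw [DirectSum.decompose_of_mem_ne ℳ (hM.graded _ _ _ (hf n) _ hx) h]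
        exact zero_mem N)
  rcases hN with hN | hN
  · exact absurd ((AddSubgroup.eq_bot_iff_forall N).1 hN _ ⟨b, rfl⟩) hb
  · exact (hN ▸ AddSubgroup.mem_top y : y ∈ N)

theorem vtx_mem_gr (v : V) : 𝓋[v] ∈ E.gr K 0 :=
  Submodule.subset_span ⟨v, [], v, [], v, rfl, rfl, rfl, (vtx_mul_self v).symm⟩

theorem gap_mem_gr (v : V) (F : Finset A) : E.gap K v F ∈ E.gr K 0 := by
  have hgap : E.gap K v F = 𝓋[v] + (-1 : K) • E.edgeProj K F :=
    (sub_eq_add_neg 𝓋[v] _).trans (congrArg (𝓋[v] + ·) (neg_one_smul K _).symm)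
  rw [hgap]
  refine add_mem (vtx_mem_gr v) (Submodule.smul_mem _ _ (Submodule.sum_mem _ fun e _ => ?_))
  refine Submodule.subset_span ⟨E.src e, [e], E.src e, [e], E.rng e, ⟨rfl, rfl⟩, ⟨rfl, rfl⟩,
    by simp, ?_⟩
  rw [pathElt, pathElt, ghostElt, ghostElt, edge_mul_rng, rng_mul_ghost]

/-- If `a` does not annihilate the module generated by `x`, then some monomial `pq*` witnesses
this. -/
theorem exists_mono_ne_zero {a b : E.LPA K} {x : M} (h : ρ (a * b) x ≠ 0) :
    ∃ u p v q w, E.IsPath u p w ∧ E.IsPath v q w ∧ ρ (E.ghostElt K v q) x ≠ 0 ∧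
      ∃ y, ρ (a * E.pathElt K u p) y ≠ 0 := by
  by_contra! hcon
  apply h
  induction b using lpa_induction with
  | zero => rw [mul_zero, rep_zero_apply]
  | add b c hb hc =>
    rw [mul_add, rep_add_apply]
    by_cases h₁ : ρ (a * b) x = 0
    · by_cases h₂ : ρ (a * c) x = 0
      · rw [h₁, h₂, add_zero]
      · exact absurd (hc h₂) h₂
    · exact absurd (hb h₁) h₁
  | mono k u p v q w hp hq =>
    by_cases h0 : ρ (E.ghostElt K v q) x = 0
    · rw [← smul_mul_assoc, ← mul_assoc, rep_mul_apply, h0, map_zero]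
    · rw [← mul_smul_comm, ← mul_assoc, rep_mul_apply]
      exact hcon u p v q w hp hq h0 _

theorem src_eq_of_vtx_mul_ne {u v w : V} {p : List A} (hp : E.IsPath u p w)
    (h : ρ (𝓋[v] * E.pathElt K u p) ≠ 0) : v = u := by
  by_contra hne
  apply h
  rw [← vtx_mul_pathElt K hp, ← mul_assoc, vtx_mul_ne hne, zero_mul, map_zero]

/-- At a gap vertex there is a nonzero homogeneous element which is annihilated by all ghost
paths of positive length. -/
theorem IsGradedSimple.exists_of_mem_gapVerts (hM : IsGradedSimple ρ ℳ) {v : V}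
    (hv : v ∈ gapVerts ρ) : ∃ j, ∃ x ∈ ℳ j, x ≠ 0 ∧ ρ 𝓋[v] x = x ∧
      ∀ u q w, E.IsPath u q w → ρ (E.ghostElt K u q) x ≠ 0 → u = v ∧ q = [] := by
  obtain ⟨F, hF, hne⟩ := hv
  have hsrc : ∀ e ∈ F, E.src e = v := fun e he => ((Set.ext_iff.1 hF e).1 he).1
  obtain ⟨j, y, hy, hne⟩ := exists_homogeneous (ℳ := ℳ) hne
  have hvx : ρ 𝓋[v] (ρ (E.gap K v F) y) = ρ (E.gap K v F) y := by
    rw [← rep_mul_apply, vtx_mul_gap hsrc]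
  refine ⟨0 + j, ρ (E.gap K v F) y, hM.graded _ _ _ (gap_mem_gr v F) _ hy, hne, hvx, ?_⟩
  intro u q w hq hqne
  have huv : u = v := by
    by_contra huv
    apply hqne
    rw [← hvx, ← ghostElt_mul_vtx K hq, ← rep_mul_apply, mul_assoc, vtx_mul_ne huv, mul_zero,
      rep_zero_apply]
  refine ⟨huv, ?_⟩
  cases q with
  | nil => rfl
  | cons e q =>
    exfalso
    apply hqne
    rw [ghostElt, ← rep_mul_apply, mul_assoc]
    -- Edges in F are cancelled by the gap element; edges at v outside F end outside the support, so
    -- their ghosts act as zero.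
    by_cases he : e ∈ F
    · rw [ghost_mul_gap_mem hsrc he, mul_zero, rep_zero_apply]
    · have hr : E.rng e ∉ support ρ := fun h => he (by
        rw [← Finset.mem_coe, hF]
        exact ⟨hq.1.trans huv, h⟩)
      rw [ghost_mul_gap_notMem (hq.1.trans huv) he, map_mul, map_ghost_eq_zero hr, mul_zero]
      rfl

/-- Every vertex of the support reaches a gap vertex. -/
theorem IsGradedSimple.reaches_gapVert (hM : IsGradedSimple ρ ℳ) {u v : V}
    (hu : u ∈ support ρ) (hv : v ∈ gapVerts ρ) : E.Reaches u v := by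
  obtain ⟨j, x, hx, hx0, hvx, hxq⟩ := hM.exists_of_mem_gapVerts hv
  obtain ⟨z, hz⟩ : ∃ z, ρ 𝓋[u] z ≠ 0 := by
    by_contra! h
    exact hu (AddMonoidHom.ext h)
  -- Expanding z = bx into monomials pq*, only those with q trivial at v act nontrivially on x; one
  -- with source u gives the path from u to v.
  obtain ⟨b, rfl⟩ := hM.exists_rep_eq hx (b := 𝓋[v]) (by rwa [hvx]) z
  rw [← rep_mul_apply] at hz
  obtain ⟨u', p, v', q, w, hp, hq, hq0, y, hy⟩ := exists_mono_ne_zero hz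
  obtain ⟨rfl, rfl⟩ := hxq _ _ _ hq hq0
  obtain rfl : v' = w := hq
  rw [src_eq_of_vtx_mul_ne hp (rep_ne_zero hy)]
  exact ⟨p, hp⟩

/-- M is spanned by the px, where x is the special vector at v and p ends at v. The gap element at
v' kills every such px with p of positive length, and it kills x itself unless v' = v. -/
theorem IsGradedSimple.gapVerts_subsingleton (hM : IsGradedSimple ρ ℳ) :
    (gapVerts ρ).Subsingleton := by
  intro v' hv' v hv
  obtain ⟨j, x, hx, hx0, hvx, hxq⟩ := hM.exists_of_mem_gapVerts hv
  obtain ⟨F, hF, hne⟩ := hv'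
  have hsrc : ∀ e ∈ F, E.src e = v' := fun e he => ((Set.ext_iff.1 hF e).1 he).1
  obtain ⟨z, hz⟩ : ∃ z, ρ (E.gap K v' F) z ≠ 0 := by
    by_contra! h
    exact hne (AddMonoidHom.ext h)
  obtain ⟨b, rfl⟩ := hM.exists_rep_eq hx (b := 𝓋[v]) (by rwa [hvx]) z
  rw [← rep_mul_apply] at hz
  obtain ⟨u', p, v'', q, w, hp, hq, hq0, y, hy⟩ := exists_mono_ne_zero hz
  obtain ⟨rfl, rfl⟩ := hxq _ _ _ hq hq0
  obtain rfl : v'' = w := hq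
  have hu' : v' = u' := by
    by_contra hu'
    apply hy
    classical
    rw [← vtx_mul_pathElt K hp, ← mul_assoc, gap, lpa_sub_mul, edgeProj_mul_vtx,
      vtx_mul_ne hu', Finset.filter_false_of_mem (fun e he h => hu' ((hsrc e he).symm.trans h)),
      edgeProj, Finset.sum_empty, lpa_sub_zero, zero_mul, rep_zero_apply]
  subst hu'
  cases p with
  | nil => exact hp
  | cons e p =>
    exfalso
    apply hy
    rw [pathElt, ← mul_assoc]
    by_cases he : e ∈ F
    · rw [gap_mul_edge_mem hsrc he, zero_mul, rep_zero_apply]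
    · have hr : E.rng e ∉ support ρ := fun h => he (by
        rw [← Finset.mem_coe, hF]
        exact ⟨hp.1, h⟩)
      rw [gap_mul_edge_notMem hp.1 he, map_mul, map_edge_eq_zero hr, zero_mul]
      rfl

/-! ### The countable separation property -/

/-- The sum of the subgroups `pM`, where `p` is a path of length at most `n` from `v` to a vertex
reached by `u`. -/
def pathSpan (ρ : E.LPA K →ₙ+* AddMonoid.End M) (u : V) (n : ℕ) (v : V) : AddSubgroup M :=
  AddSubgroup.closure {x | ∃ p w y, E.IsPath v p w ∧ E.Reaches u w ∧ p.length ≤ n ∧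
    x = ρ (E.pathElt K v p) y}

theorem pathSpan_mono {u v : V} {m n : ℕ} (h : m ≤ n) :
    pathSpan ρ u m v ≤ pathSpan ρ u n v :=
  AddSubgroup.closure_mono fun _ ⟨p, w, y, hp, hu, hm, hx⟩ => ⟨p, w, y, hp, hu, hm.trans h, hx⟩

theorem pathSpan_zero {u v : V} (h : ¬ E.Reaches u v) : pathSpan ρ u 0 v = ⊥ := by
  rw [pathSpan, AddSubgroup.closure_eq_bot_iff]
  rintro x ⟨p, w, y, hp, hu, hn, -⟩
  obtain rfl := List.length_eq_zero_iff.1 (Nat.le_zero.1 hn)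
  obtain rfl : v = w := hp
  exact absurd hu h

/-- As u does not reach v, the trivial path at v does not contribute, so every generator starts with
an edge, which its ghost removes. -/
theorem exists_of_mem_pathSpan_succ {u v : V} (h : ¬ E.Reaches u v) {n : ℕ} {m : M}
    (hm : m ∈ pathSpan ρ u (n + 1) v) :
    (∃ F : Finset A, (∀ e ∈ F, E.src e = v) ∧ ρ (E.edgeProj K F) m = m) ∧
      ∀ e, ρ ℊ[e] m ∈ pathSpan ρ u n (E.rng e) := by
  classical
  induction hm using AddSubgroup.closure_induction with
  | mem x hx =>
    obtain ⟨p, w, y, hp, hu, hn, rfl⟩ := hx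
    cases p with
    | nil =>
      obtain rfl : v = w := hp
      exact absurd hu h
    | cons f p =>
      rw [pathElt]
      refine ⟨⟨{f}, by simpa using hp.1, ?_⟩, fun e => ?_⟩
      · rw [← rep_mul_apply, ← mul_assoc, edgeProj_mul_edge (by simp)]
      · rw [← rep_mul_apply, ← mul_assoc]
        by_cases hef : e = f
        · subst hef
          rw [ghost_mul_edge, vtx_mul_pathElt K hp.2]
          exact AddSubgroup.subset_closure ⟨p, w, y, hp.2, hu, by simpa using hn, rfl⟩
        · rw [ghost_mul_edge_ne hef, zero_mul, rep_zero_apply]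
          exact zero_mem _
  | zero => exact ⟨⟨∅, by simp, map_zero _⟩, fun e => by rw [map_zero]; exact zero_mem _⟩
  | add x y _ _ hx hy =>
    obtain ⟨⟨F, hFs, hF⟩, hx⟩ := hx
    obtain ⟨⟨G, hGs, hG⟩, hy⟩ := hy
    refine ⟨⟨F ∪ G, ?_, ?_⟩, fun e => ?_⟩
    · intro e he
      rcases Finset.mem_union.1 he with he | he
      exacts [hFs e he, hGs e he]
    · rw [map_add, ← hF, ← hG, ← rep_mul_apply, ← rep_mul_apply,
        edgeProj_mul_of_subset Finset.subset_union_left,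
        edgeProj_mul_of_subset Finset.subset_union_right]
    · rw [map_add]
      exact add_mem (hx e) (hy e)
  | neg x _ hx =>
    obtain ⟨⟨F, hFs, hF⟩, hx⟩ := hx
    exact ⟨⟨F, hFs, by rw [map_neg, hF]⟩, fun e => by rw [map_neg]; exact neg_mem (hx e)⟩

/-- The point is that C depends on m, v and n but not on u. If u does not reach v, then m is the sum
of the e(e*m) over finitely many edges e at v, and each nonzero e*m lies in the corresponding span
at r(e) with shorter paths. So v together with the sets obtained from these e*m suffices. -/
theorem exists_countable_of_pathSpan (n : ℕ) (v : V) (m : M) (hm : ρ 𝓋[v] m = m) (hm0 : m ≠ 0) :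
    ∃ C : Set V, C.Countable ∧ (∀ w ∈ C, E.Reaches v w ∧ w ∈ support ρ) ∧
      ∀ u, m ∈ pathSpan ρ u n v → ∃ w ∈ C, E.Reaches u w := by
  have hv : v ∈ support ρ := rep_ne_zero (m := m) (by rwa [hm])
  induction n generalizing v m with
  | zero =>
    refine ⟨{v}, Set.countable_singleton v, ?_, fun u hu => ⟨v, rfl, ?_⟩⟩
    · rintro w rfl
      exact ⟨Reaches.refl w, hv⟩
    · by_contra h
      rw [pathSpan_zero h] at hu
      exact hm0 hu
  | succ n ih =>
    -- This alternative does not mention u. If it fails, every u in question reaches v itself.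
    by_cases hex : ∃ F : Finset A, (∀ e ∈ F, E.src e = v) ∧ ρ (E.edgeProj K F) m = m
    · obtain ⟨F, hFs, hF⟩ := hex
      have step : ∀ e : A, ∃ C : Set V, C.Countable ∧ (ρ ℊ[e] m ≠ 0 →
          (∀ w ∈ C, E.Reaches (E.rng e) w ∧ w ∈ support ρ) ∧
          ∀ u, ρ ℊ[e] m ∈ pathSpan ρ u n (E.rng e) → ∃ w ∈ C, E.Reaches u w) := by
        intro e
        by_cases he : ρ ℊ[e] m = 0
        · exact ⟨∅, Set.countable_empty, fun h => absurd he h⟩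
        · have h₁ : ρ 𝓋[E.rng e] (ρ ℊ[e] m) = ρ ℊ[e] m := by
            rw [← rep_mul_apply, rng_mul_ghost]
          obtain ⟨C, hC, h⟩ := ih _ _ h₁ he (rep_ne_zero (m := ρ ℊ[e] m) (by rwa [h₁]))
          exact ⟨C, hC, fun _ => h⟩
      choose C hC hCe using step
      refine ⟨{v} ∪ ⋃ e ∈ {e | e ∈ F ∧ ρ ℊ[e] m ≠ 0}, C e, ?_, ?_, ?_⟩
      · refine (Set.countable_singleton v).union (Set.Countable.biUnion ?_ fun e _ => hC e)
        exact (F.finite_toSet.subset fun e he => he.1).countable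
      · rintro w (rfl | hw)
        · exact ⟨Reaches.refl w, hv⟩
        · obtain ⟨e, ⟨heF, he⟩, hw⟩ := Set.mem_iUnion₂.1 hw
          obtain ⟨h₁, h₂⟩ := (hCe e he).1 w hw
          exact ⟨(hFs e heF ▸ reaches_rng e).trans h₁, h₂⟩
      · intro u hu
        by_cases huv : E.Reaches u v
        · exact ⟨v, Or.inl rfl, huv⟩
        · obtain ⟨-, hmem⟩ := exists_of_mem_pathSpan_succ huv hu
          obtain ⟨e, heF, he⟩ : ∃ e ∈ F, ρ ℊ[e] m ≠ 0 := by
            by_contra! h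
            apply hm0
            rw [← hF, edgeProj, rep_sum_apply]
            refine Finset.sum_eq_zero fun e he => ?_
            rw [rep_mul_apply, h e he, map_zero]
          obtain ⟨w, hw, huw⟩ := (hCe e he).2 u (hmem e)
          exact ⟨w, Or.inr (Set.mem_iUnion₂.2 ⟨e, ⟨heF, he⟩, hw⟩), huw⟩
    · refine ⟨{v}, Set.countable_singleton v, ?_, fun u hu => ⟨v, rfl, ?_⟩⟩
      · rintro w rfl
        exact ⟨Reaches.refl w, hv⟩
      · by_contra h
        exact hex (exists_of_mem_pathSpan_succ h hu).1

/-- A monomial pq* surviving in vcu has s(p) = v and s(q) = u, so q shows that u reaches the end of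
p. -/
theorem exists_mem_pathSpan (u v : V) (x : M) (c : E.LPA K) :
    ∃ n, ρ 𝓋[v] (ρ (c * 𝓋[u]) x) ∈ pathSpan ρ u n v := by
  induction c using lpa_induction with
  | zero => exact ⟨0, by rw [zero_mul, rep_zero_apply, map_zero]; exact zero_mem _⟩
  | add a b ha hb =>
    obtain ⟨m, hm⟩ := ha
    obtain ⟨n, hn⟩ := hb
    refine ⟨max m n, ?_⟩
    rw [add_mul, rep_add_apply, map_add]
    exact add_mem (pathSpan_mono (le_max_left _ _) hm) (pathSpan_mono (le_max_right _ _) hn)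
  | mono k v' p u' q w hp hq =>
    by_cases hv : v = v'
    · by_cases hu : u' = u
      · subst hv hu
        refine ⟨p.length, AddSubgroup.subset_closure
          ⟨p, w, ρ (k • E.ghostElt K u' q) x, hp, ⟨q, hq⟩, le_rfl, ?_⟩⟩
        rw [← rep_mul_apply, ← rep_mul_apply, smul_mul_assoc, mul_assoc, ghostElt_mul_vtx K hq,
          mul_smul_comm, ← mul_assoc, vtx_mul_pathElt K hp, mul_smul_comm]
      · refine ⟨0, ?_⟩
        rw [← ghostElt_mul_vtx K hq, smul_mul_assoc, mul_assoc, mul_assoc, vtx_mul_ne hu, mul_zero,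
          mul_zero, smul_zero, rep_zero_apply, map_zero]
        exact zero_mem _
    · refine ⟨0, ?_⟩
      rw [← vtx_mul_pathElt K hp, smul_mul_assoc, ← rep_mul_apply, mul_smul_comm, ← mul_assoc,
        ← mul_assoc, ← mul_assoc, vtx_mul_ne hv, zero_mul, zero_mul, zero_mul, smul_zero,
        rep_zero_apply]
      exact zero_mem _

/-- The support of a graded simple module is the root of a countable set of vertices which are
reached by a given vertex. -/
theorem IsGradedSimple.exists_countable (hM : IsGradedSimple ρ ℳ) {v : V}
    (hv : v ∈ support ρ) : ∃ C : Set V, C.Countable ∧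
      (∀ w ∈ C, E.Reaches v w ∧ w ∈ support ρ) ∧
      ∀ u ∈ support ρ, ∃ w ∈ C, E.Reaches u w := by
  obtain ⟨j, y, hy, hne⟩ := exists_homogeneous (ℳ := ℳ) hv
  set m := ρ 𝓋[v] y with hmdef
  have hm : ρ 𝓋[v] m = m := by rw [hmdef, ← rep_mul_apply, vtx_mul_self]
  have hmj : m ∈ ℳ (0 + j) := hM.graded _ _ _ (vtx_mem_gr v) _ hy
  choose C hC₁ hC₂ hC₃ using fun n => exists_countable_of_pathSpan (ρ := ρ) n v m hm hne
  refine ⟨⋃ n, C n, Set.countable_iUnion hC₁, fun w hw => ?_, fun u hu => ?_⟩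
  · obtain ⟨n, hn⟩ := Set.mem_iUnion.1 hw
    exact hC₂ n w hn
  · obtain ⟨i, z, hz, hz0⟩ := exists_homogeneous (ℳ := ℳ) hu
    have hzi : ρ 𝓋[u] z ∈ ℳ (0 + i) := hM.graded _ _ _ (vtx_mem_gr u) _ hz
    -- The vector uz generates M, so it yields the fixed vector m. The set C was built from m alone,
    -- before u was chosen.
    obtain ⟨c, hc⟩ := hM.exists_rep_eq hzi (b := 𝓋[u])
      (by rwa [← rep_mul_apply, vtx_mul_self]) m
    obtain ⟨n, hn⟩ := exists_mem_pathSpan (ρ := ρ) u v z c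
    rw [rep_mul_apply, hc, hm] at hn
    obtain ⟨w, hw, huw⟩ := hC₃ n u hn
    exact ⟨w, Set.mem_iUnion.2 ⟨n, hw⟩, huw⟩

theorem IsGradedSimple.support_nonempty (hM : IsGradedSimple ρ ℳ) : (support ρ).Nonempty := by
  obtain ⟨a, m, h⟩ := hM.nontrivial
  by_contra hne
  rw [Set.not_nonempty_iff_eq_empty] at hne
  apply h
  induction a using lpa_induction with
  | zero => exact rep_zero_apply ρ m
  | add a b ha hb =>
    by_cases h₁ : ρ a m = 0
    · by_cases h₂ : ρ b m = 0
      · rw [rep_add_apply, h₁, h₂, add_zero]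
      · exact absurd (hb h₂) h₂
    · exact absurd (ha h₁) h₁
  | mono k u p v q w hp hq =>
    have hu : u ∉ support ρ := hne ▸ Set.notMem_empty u
    rw [← vtx_mul_pathElt K hp, mul_assoc, ← mul_smul_comm, map_mul, not_not.1 hu, zero_mul]
    rfl

end

/-! ### Kernels of the modules of branching systems -/

namespace Branching

variable {X : Type*} (B : E.Branching X)

variable (K) in
/-- An element of `L_K(E)` as a linear endomorphism of `M(X)`. -/
noncomputable def linRep (a : E.LPA K) : Module.End K (X →₀ K) :=
  RingQuot.liftAlgHom K (s := E.Rel K) ⟨FreeAlgebra.lift K (B.act K), B.act_rel K⟩ a.1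

theorem rep_apply (a : E.LPA K) (m : X →₀ K) : B.rep K a m = B.linRep K a m := rfl

theorem linRep_mul (a b : E.LPA K) (m : X →₀ K) :
    B.linRep K (a * b) m = B.linRep K a (B.linRep K b m) :=
  rep_mul_apply (B.rep K) a b m

theorem linRep_smul (k : K) (a : E.LPA K) (m : X →₀ K) :
    B.linRep K (k • a) m = k • B.linRep K a m := by
  rw [linRep, show (k • a).1 = k • a.1 from rfl, map_smul]
  rfl

theorem linRep_apply_apply (a : E.LPA K) (m : X →₀ K) (y : X) :
    B.linRep K a m y = m.sum fun z c => c * B.linRep K a (Finsupp.single z 1) y := by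
  conv_lhs => rw [← m.sum_single]
  rw [map_finsuppSum, Finsupp.sum, Finsupp.finsetSum_apply, Finsupp.sum]
  refine Finset.sum_congr rfl fun z _ => ?_
  rw [← mul_one (m z), ← smul_eq_mul, ← Finsupp.smul_single, map_smul, Finsupp.smul_apply,
    smul_eq_mul, smul_eq_mul, mul_one]

theorem rep_eq_zero_iff (a : E.LPA K) :
    B.rep K a = 0 ↔ ∀ x, B.rep K a (Finsupp.single x 1) = 0 := by
  refine ⟨fun h x => by rw [h]; rfl, fun h => mem_ann.1 fun m => ?_⟩
  rw [rep_apply]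
  ext y
  rw [linRep_apply_apply]
  refine Finset.sum_eq_zero fun z _ => ?_
  simp only [← rep_apply]
  rw [h z, Finsupp.zero_apply, mul_zero]

theorem mem_support_rep {v : V} : v ∈ support (B.rep K) ↔ (B.vset v).Nonempty := by
  rw [mem_support, Ne, rep_eq_zero_iff, not_forall]
  simp only [rep_lgen]
  refine exists_congr fun x => ?_
  by_cases h : x ∈ B.vset v
  · simp [act_vtx_mem K B h, h]
  · simp [act_vtx_notMem K B h, h]

theorem rng_mem_support_of_mem_eset {e : A} {x : X} (h : x ∈ B.eset e) :
    E.rng e ∈ support (B.rep K) :=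
  B.mem_support_rep.2 ⟨_, ((B.σ e).symm ⟨x, h⟩).2⟩

theorem rep_edgeProj_mem {F : Finset A} {e : A} (he : e ∈ F) {x : X} (hx : x ∈ B.eset e) :
    B.rep K (E.edgeProj K F) (Finsupp.single x 1) = Finsupp.single x 1 := by
  rw [edgeProj, rep_sum_apply, Finset.sum_eq_single_of_mem e he, rep_mul_apply, rep_lgen,
    rep_lgen, act_edge_ghost_mem K B hx]
  intro f _ hf
  rw [rep_mul_apply, rep_lgen K B (.ghost f), act_ghost_notMem, map_zero]
  exact fun h => Set.disjoint_left.1 (B.eset_disjoint f e hf) h hx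

theorem rep_edgeProj_notMem {F : Finset A} {x : X} (hx : ∀ e ∈ F, x ∉ B.eset e) :
    B.rep K (E.edgeProj K F) (Finsupp.single x 1) = 0 := by
  rw [edgeProj, rep_sum_apply]
  refine Finset.sum_eq_zero fun e he => ?_
  rw [rep_mul_apply, rep_lgen K B (.ghost e), act_ghost_notMem K B (hx e he), map_zero]

theorem rep_gap_apply (v : V) (F : Finset A) (m : X →₀ K) :
    B.rep K (E.gap K v F) m = B.rep K 𝓋[v] m - B.rep K (E.edgeProj K F) m := by
  rw [gap, lpa_map_sub]
  rfl

theorem src_eq_of_mem {e : A} {v : V} {x : X} (he : x ∈ B.eset e) (hv : x ∈ B.vset v) :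
    E.src e = v := by
  by_contra h
  exact Set.disjoint_left.1 (B.vset_disjoint _ _ h) (B.eset_subset e he) hv

/-- The gap element acts as the projection onto the basis elements of X_v that lie in no X_e. Edges
leaving the support do not matter, since their sets X_e are empty. -/
theorem mem_gapVerts_rep {v : V} : v ∈ gapVerts (B.rep K) ↔
    (E.outTo (support (B.rep K)) v).Finite ∧ ∃ x ∈ B.vset v, ∀ e, x ∉ B.eset e := by
  constructor
  · rintro ⟨F, hF, hne⟩
    refine ⟨hF ▸ F.finite_toSet, ?_⟩
    by_contra! hcon
    apply hne
    rw [rep_eq_zero_iff]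
    intro x
    rw [rep_gap_apply, rep_lgen]
    by_cases hx : x ∈ B.vset v
    · obtain ⟨e, he⟩ := hcon x hx
      have heF : e ∈ F := by
        rw [← Finset.mem_coe, hF]
        exact ⟨B.src_eq_of_mem he hx, B.rng_mem_support_of_mem_eset he⟩
      rw [act_vtx_mem K B hx, rep_edgeProj_mem B heF he, sub_self]
    · rw [act_vtx_notMem K B hx, rep_edgeProj_notMem, sub_zero]
      intro e he hxe
      have : e ∈ E.outTo (support (B.rep K)) v := hF ▸ he
      exact hx (this.1 ▸ B.eset_subset e hxe)
  · rintro ⟨hfin, x, hx, hxe⟩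
    refine ⟨hfin.toFinset, hfin.coe_toFinset, rep_ne_zero (m := Finsupp.single x 1) ?_⟩
    rw [rep_gap_apply, rep_lgen, act_vtx_mem K B hx, rep_edgeProj_notMem B fun e _ => hxe e,
      sub_zero]
    simp

theorem gapVerts_rep_eq_empty (h : ∀ x, ∃ e, x ∈ B.eset e) : gapVerts (B.rep K) = ∅ := by
  rw [Set.eq_empty_iff_forall_notMem]
  intro v hv
  obtain ⟨-, x, -, hx⟩ := B.mem_gapVerts_rep.1 hv
  obtain ⟨e, he⟩ := h x
  exact hx e he

/-! ### Degree functions on branching systems -/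

section Degree

variable (deg : X → ℤ)

/-- The action of `a` raises the degree by `n`. -/
def HasDegree (a : E.LPA K) (n : ℤ) : Prop :=
  ∀ x y, B.linRep K a (Finsupp.single x 1) y ≠ 0 → deg y = n + deg x

variable {B deg}

theorem HasDegree.mul {a b : E.LPA K} {m n : ℤ} (ha : B.HasDegree deg a m)
    (hb : B.HasDegree deg b n) : B.HasDegree deg (a * b) (m + n) := by
  intro x y h
  rw [linRep_mul, linRep_apply_apply] at h
  obtain ⟨z, -, hz⟩ := Finset.exists_ne_zero_of_sum_ne_zero h
  rw [ha z y (right_ne_zero_of_mul hz), hb x z (left_ne_zero_of_mul hz), add_assoc]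

theorem hasDegree_vtx (v : V) : B.HasDegree deg 𝓋[v] 0 := by
  intro x y h
  rw [← rep_apply, rep_lgen] at h
  by_cases hx : x ∈ B.vset v
  · rw [act_vtx_mem K B hx] at h
    rw [(Finsupp.single_apply_ne_zero.1 h).1, zero_add]
  · rw [act_vtx_notMem K B hx] at h
    exact absurd rfl h

theorem hasDegree_edge (hdeg : ∀ e x, deg (B.σ e x) = 1 + deg x) (e : A) :
    B.HasDegree deg ℯ[e] 1 := by
  intro x y h
  rw [← rep_apply, rep_lgen] at h
  by_cases hx : x ∈ B.vset (E.rng e)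
  · rw [act_edge_mem K B hx] at h
    rw [(Finsupp.single_apply_ne_zero.1 h).1, hdeg]
  · rw [act_edge_notMem K B hx] at h
    exact absurd rfl h

theorem hasDegree_ghost (hdeg : ∀ e x, deg (B.σ e x) = 1 + deg x) (e : A) :
    B.HasDegree deg ℊ[e] (-1) := by
  intro x y h
  rw [← rep_apply, rep_lgen] at h
  by_cases hx : x ∈ B.eset e
  · rw [act_ghost_mem K B hx] at h
    have := hdeg e ((B.σ e).symm ⟨x, hx⟩)
    rw [Equiv.apply_symm_apply] at this
    rw [(Finsupp.single_apply_ne_zero.1 h).1]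
    simp only at this
    omega
  · rw [act_ghost_notMem K B hx] at h
    exact absurd rfl h

theorem hasDegree_pathElt (hdeg : ∀ e x, deg (B.σ e x) = 1 + deg x) (u : V) (p : List A) :
    B.HasDegree deg (E.pathElt K u p) p.length := by
  induction p generalizing u with
  | nil => exact hasDegree_vtx u
  | cons e p ih =>
    rw [pathElt, List.length_cons, Nat.cast_add, Nat.cast_one, add_comm]
    exact (hasDegree_edge hdeg e).mul (ih _)

theorem hasDegree_ghostElt (hdeg : ∀ e x, deg (B.σ e x) = 1 + deg x) (u : V) (p : List A) :
    B.HasDegree deg (E.ghostElt K u p) (-p.length) := by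
  induction p generalizing u with
  | nil => exact hasDegree_vtx u
  | cons e p ih =>
    rw [ghostElt, List.length_cons, Nat.cast_add, Nat.cast_one, neg_add]
    exact (ih _).mul (hasDegree_ghost hdeg e)

theorem hasDegree_of_mem_gr (hdeg : ∀ e x, deg (B.σ e x) = 1 + deg x) {n : ℤ} {a : E.LPA K}
    (ha : a ∈ E.gr K n) :
    B.HasDegree deg a n := by
  refine gr_induction (C := fun a => B.HasDegree deg a n) ?_ (fun a b ha hb => ?_)
    (fun k u p v q w _ _ hn => ?_) ha
  · intro x y h
    rw [← rep_apply, rep_zero_apply] at h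
    exact absurd rfl h
  · intro x y h
    rw [← rep_apply, rep_add_apply, Finsupp.add_apply] at h
    by_cases h₁ : B.linRep K a (Finsupp.single x 1) y = 0
    · refine hb x y fun h₂ => h ?_
      rw [rep_apply, rep_apply, h₁, h₂, add_zero]
    · exact ha x y h₁
  · intro x y h
    rw [linRep_smul, Finsupp.smul_apply] at h
    rw [← hn, sub_eq_add_neg]
    exact (hasDegree_pathElt hdeg u p).mul (hasDegree_ghostElt hdeg v q) x y
      (right_ne_zero_of_smul h)

/-- In the column of a basis element x, components of different degrees have their nonzero entries
in disjoint sets of rows. -/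
theorem kerGraded_rep (hdeg : ∀ e x, deg (B.σ e x) = 1 + deg x) : KerGraded (B.rep K) := by
  intro s f hf h0 n hn
  rw [rep_eq_zero_iff]
  intro x
  ext y
  by_contra hne
  have hdy := hasDegree_of_mem_gr hdeg (hf n) x y hne
  have h : B.rep K (∑ i ∈ s, f i) (Finsupp.single x 1) y = 0 := by
    rw [h0]
    rfl
  rw [rep_sum_apply, Finsupp.finsetSum_apply, Finset.sum_eq_single_of_mem n hn] at h
  · exact hne h
  · intro i _ hi
    by_contra hne'
    have := hasDegree_of_mem_gr hdeg (hf i) x y hne'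
    omega

end Degree

end Branching

/-! ### The three families of modules -/

theorem IsInfPath.reaches {α : ℕ → A} (hα : E.IsInfPath α) (m n : ℕ) :
    E.Reaches (E.src (α m)) (E.src (α (m + n))) := by
  induction n with
  | zero => exact Reaches.refl _
  | succ n ih =>
    refine ih.trans ?_
    rw [← Nat.add_assoc, ← hα (m + n)]
    exact reaches_rng _

theorem exists_infX {α : ℕ → A} (hα : E.IsInfPath α) (n : ℕ) {u : V} {p : List A}
    (hp : E.IsPath u p (E.src (α n))) : ∃ β : E.InfX α, E.src (β.path 0) = u := by
  induction p generalizing u with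
  | nil =>
    refine ⟨⟨fun k => α (n + k), fun k => hα (n + k), n, 0, fun k => by simp⟩, ?_⟩
    exact (show u = _ from hp).symm
  | cons e p ih =>
    obtain ⟨β, hβ⟩ := ih hp.2
    exact ⟨⟨consPath e β.path, E.consPath_isInfPath β.isInfPath hβ, β.tailEquiv.consPath e⟩, hp.1⟩

theorem support_repV {α : ℕ → A} (hα : E.IsInfPath α) :
    support (E.repV K α) = E.root (E.infVerts α) := by
  ext v
  rw [repV, Branching.mem_support_rep]
  constructor
  · rintro ⟨β, rfl⟩
    obtain ⟨m, n, h⟩ := β.tailEquiv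
    refine ⟨_, ⟨m, rfl⟩, ?_⟩
    have := β.isInfPath.reaches 0 n
    rw [Nat.zero_add] at this
    rwa [← show α m = β.path n from h 0] at this
  · rintro ⟨_, ⟨n, rfl⟩, p, hp⟩
    obtain ⟨β, hβ⟩ := exists_infX hα n hp
    exact ⟨β, hβ⟩

theorem gapVerts_repV (α : ℕ → A) : gapVerts (E.repV K α) = ∅ :=
  (E.infBranching α).gapVerts_rep_eq_empty fun β => ⟨β.path 0, rfl⟩

/-- The sequence `α` is periodic from some index on. -/
def EventuallyPeriodic (α : ℕ → A) : Prop := ∃ a L, 0 < L ∧ ∀ j, α (a + L + j) = α (a + j)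

theorem eventuallyPeriodic_of_eq {α : ℕ → A} {a b : ℕ} (hab : a ≠ b)
    (h : ∀ j, α (a + j) = α (b + j)) : EventuallyPeriodic α := by
  rcases hab.lt_or_gt with hlt | hlt
  · exact ⟨a, b - a, by omega, fun j => by rw [h j]; congr 1; omega⟩
  · exact ⟨b, a - b, by omega, fun j => by rw [← h j]; congr 1; omega⟩

/-- The degree of β is the shift n - m between the matching tails of β and α. It is well defined
because two different shifts would make α overlap with a translate of itself and hence be eventually
periodic. -/
theorem kerGraded_repV {α : ℕ → A} (hα : ¬ EventuallyPeriodic α) : KerGraded (E.repV K α) := by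
  have key : ∀ (β : ℕ → A) (m n m' n' : ℕ), (∀ k, α (m + k) = β (n + k)) →
      (∀ k, α (m' + k) = β (n' + k)) → (n : ℤ) - m = n' - m' := by
    intro β m n m' n' h h'
    by_contra hne
    refine hα (eventuallyPeriodic_of_eq (a := m + n') (b := m' + n) (by omega) fun j => ?_)
    rw [Nat.add_assoc, h, Nat.add_assoc m', h']
    congr 1
    omega
  choose m n h using fun β : E.InfX α => β.tailEquiv
  refine Branching.kerGraded_rep (deg := fun β => (n β : ℤ) - m β) fun e β => ?_
  have h₁ := h β
  have h₂ := h ((E.infBranching α).σ e β)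
  have := key ((E.infBranching α).σ e β : E.InfX α).path _ _ (m β) (n β + 1) h₂ fun k => by
    rw [h₁ k, Nat.add_right_comm]
    rfl
  rw [this]
  push_cast
  ring

/-! ### The modules of sinks and infinite emitters -/

theorem support_repN {v : V} (hv : ¬ E.IsRegular v) : support (E.repN K v hv) = E.root {v} := by
  ext u
  rw [repN, Branching.mem_support_rep]
  constructor
  · rintro ⟨x, rfl⟩
    exact ⟨v, rfl, x.edges, x.isPath⟩
  · rintro ⟨_, rfl, p, hp⟩
    exact ⟨⟨u, p, hp⟩, rfl⟩

/-- Only the trivial path at v lies in no X_e, and the edges from v into the support are its return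
edges. With infinitely many of them no gap element is formed, which is why this case behaves like an
extreme cycle. -/
theorem mem_gapVerts_repN {u v : V} (hv : ¬ E.IsRegular v) :
    u ∈ gapVerts (E.repN K v hv) ↔ u = v ∧ (E.returnEdges v).Finite := by
  have hs := support_repN (K := K) hv
  rw [repN] at hs
  rw [repN, Branching.mem_gapVerts_rep, hs]
  constructor
  · rintro ⟨hfin, ⟨u', p, hp⟩, rfl, hx⟩
    cases p with
    | nil =>
      obtain rfl : u' = v := hp
      exact ⟨rfl, hfin⟩
    | cons e p => exact absurd ⟨p, rfl⟩ (hx e)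
  · rintro ⟨rfl, hfin⟩
    refine ⟨hfin, ⟨u, [], rfl⟩, rfl, ?_⟩
    rintro e ⟨l, hl⟩
    simp at hl

theorem kerGraded_repN {v : V} (hv : ¬ E.IsRegular v) : KerGraded (E.repN K v hv) := by
  refine Branching.kerGraded_rep (deg := fun x => (x.edges.length : ℤ)) fun e x => ?_
  change ((e :: x.1.edges).length : ℤ) = _
  rw [List.length_cons]
  push_cast
  ring

/-! ### The modules of exclusive cycles -/

theorem stripPrefix_length_sub (p q : List A) :
    ((stripPrefix p q).1.length : ℤ) - (stripPrefix p q).2.length = p.length - q.length := by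
  induction p generalizing q with
  | nil => simp [stripPrefix]
  | cons e p ih =>
    cases q with
    | nil => simp [stripPrefix]
    | cons f q =>
      by_cases h : e = f
      · simp [stripPrefix, h, ih]
      · simp [stripPrefix, h]

theorem red_length_sub (p q : List A) :
    ((red p q).1.length : ℤ) - (red p q).2.length = p.length - q.length := by
  simpa [red] using stripPrefix_length_sub p.reverse q.reverse

/-- The degree |p| - |q| is unchanged by cancelling common last edges. -/
theorem kerGraded_repC {c : List A} (hc : E.IsExclusive c) {v : V} (hv : v ∈ E.cycVerts c) :
    KerGraded (repC K hc hv) := by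
  refine Branching.kerGraded_rep (deg := fun x => (x.p.length : ℤ) - x.q.length) fun e x => ?_
  refine (red_length_sub (e :: x.1.p) x.1.q).trans ?_
  rw [List.length_cons]
  push_cast
  ring

theorem support_repC {c : List A} (hc : E.IsExclusive c) {v : V} (hv : v ∈ E.cycVerts c) :
    support (repC K hc hv) = E.root (E.cycVerts c) := by
  ext u
  rw [repC, Branching.mem_support_rep]
  constructor
  · rintro ⟨x, rfl⟩
    obtain ⟨w, hw, hp, -⟩ := x.memY
    exact ⟨w, hw, x.p, hp⟩
  · rintro ⟨w, hw, p, hp⟩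
    obtain ⟨⟨z, hz⟩, -⟩ := id hc
    obtain ⟨q, hq, -⟩ := E.exists_segment hz hv hw
    have h : E.MemY c v u p q := ⟨w, hw, hp, hq⟩
    exact ⟨⟨u, _, _, h.red hc hv, red_idem p q⟩, rfl⟩

/-- Every basis element lies in some X_e: if p is trivial, then q* is the reduction of e(qe)*, where
e is the edge of the cycle that starts at the end of q. -/
theorem gapVerts_repC {c : List A} (hc : E.IsExclusive c) {v : V} (hv : v ∈ E.cycVerts c) :
    gapVerts (repC K hc hv) = ∅ := by
  refine (cycBranching hc hv).gapVerts_rep_eq_empty fun x => ?_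
  obtain ⟨z, hz, h₁, h₂⟩ := x.memY
  rcases hp : x.p with _ | ⟨e, p⟩
  · rw [hp] at h₁
    have h₁ : x.start = z := h₁
    obtain ⟨e, he, hez⟩ := id hz
    obtain ⟨⟨u, hu⟩, -⟩ := id hc
    refine ⟨e, [], x.q ++ [e], ⟨E.rng e, E.rng_mem_cycVerts hu he, rfl,
      E.isPath_append.2 ⟨z, h₂, hez, rfl⟩⟩, ?_⟩
    have := red_singleton_snoc x.q e
    refine CycX.ext (h₁.trans hez.symm) ?_ (congrArg Prod.snd this).symm
    rw [hp]
    exact (congrArg Prod.fst this).symm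
  · rw [hp] at h₁
    refine ⟨e, p, x.q, ⟨z, hz, h₁.2, h₂⟩, ?_⟩
    have := x.reduced
    rw [hp] at this
    refine CycX.ext h₁.1.symm ?_ (congrArg Prod.snd this).symm
    rw [hp]
    exact (congrArg Prod.fst this).symm

/-! ### The type is determined by the annihilator -/

theorem mem_root_singleton {u v : V} : u ∈ E.root {v} ↔ E.Reaches u v := by
  simp [root]

theorem mem_root_of_mem {S : Set V} {v : V} (h : v ∈ S) : v ∈ E.root S :=
  ⟨v, h, Reaches.refl v⟩

variable (E) in
/-- The properties of the support `W` and the set `D` of the gap vertices of a graded simple module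
which correspond to the four types of graded Chen modules. -/
def HasType (W D : Set V) : ChenType → Prop
  | .strictlyDecreasing => D = ∅ ∧ ∀ v ∈ W, ¬ W ⊆ E.root {v}
  | .relativeSink => ∃ v ∈ D, E.outTo W v = ∅
  | .extremeCycle => (∃ v ∈ D, (E.outTo W v).Nontrivial) ∨
      D = ∅ ∧ ∃ v ∈ W, W ⊆ E.root {v} ∧ (E.outTo W v).Nontrivial
  | .exclusiveCycle => (∃ v ∈ D, ∃ e, E.outTo W v = {e}) ∨
      D = ∅ ∧ (∃ v ∈ W, W ⊆ E.root {v}) ∧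
        ∀ v ∈ W, W ⊆ E.root {v} → (E.outTo W v).Subsingleton

/-- If D = {v}, the types count the edges from v into W: none, one, or at least two. If D is empty,
they ask whether W is the root of one of its vertices, and whether some such vertex has two edges
into W. -/
theorem HasType.eq {W D : Set V} (hD : D.Subsingleton) {s t : ChenType}
    (hs : E.HasType W D s) (ht : E.HasType W D t) : s = t := by
  rcases D.eq_empty_or_nonempty with rfl | ⟨v, hv⟩
  · have key : ∀ v ∈ W, W ⊆ E.root {v} → (E.outTo W v).Nontrivial →
        ¬ ∀ v ∈ W, W ⊆ E.root {v} → (E.outTo W v).Subsingleton :=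
      fun v hv h₁ h₂ h₃ => Set.not_subsingleton_iff.2 h₂ (h₃ v hv h₁)
    cases s <;> cases t <;> simp only [HasType, Set.mem_empty_iff_false, false_and, exists_false,
      false_or, true_and] at hs ht ⊢
    all_goals first
      | exact hs.elim
      | exact ht.elim
      | (obtain ⟨v, hv, h₁, h₂⟩ := hs
         first
          | exact absurd h₁ (ht v hv)
          | exact absurd ht.2 (key v hv h₁ h₂))
      | (obtain ⟨v, hv, h₁, h₂⟩ := ht
         first
          | exact absurd h₁ (hs v hv)
          | exact absurd hs.2 (key v hv h₁ h₂))
      | (obtain ⟨⟨v, hv, h₁⟩, -⟩ := hs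
         exact absurd h₁ (ht v hv))
      | (obtain ⟨⟨v, hv, h₁⟩, -⟩ := ht
         exact absurd h₁ (hs v hv))
  · obtain rfl := hD.eq_singleton_of_mem hv
    have h₁ : ∀ e, ¬ ({e} : Set A).Nontrivial := fun e => Set.not_nontrivial_singleton
    have h₂ : ¬ (∅ : Set A).Nontrivial := Set.not_nontrivial_empty
    cases s <;> cases t <;> simp only [HasType, Set.mem_singleton_iff, exists_eq_left,
      Set.singleton_ne_empty, false_and, or_false] at hs ht ⊢
    all_goals first
      | exact hs.elim
      | exact ht.elim
      | (rw [hs] at ht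
         first
          | exact absurd ht h₂
          | (obtain ⟨e, he⟩ := ht
             exact absurd he.symm (Set.singleton_ne_empty e)))
      | (rw [ht] at hs
         first
          | exact absurd hs h₂
          | (obtain ⟨e, he⟩ := hs
             exact absurd he.symm (Set.singleton_ne_empty e)))
      | (obtain ⟨e, he⟩ := hs
         rw [he] at ht
         exact absurd ht (h₁ e))
      | (obtain ⟨e, he⟩ := ht
         rw [he] at hs
         exact absurd hs (h₁ e))

/-! ### The support and the gap vertices as invariants of the annihilator -/

section

variable {M N : Type*} [AddCommGroup M] [AddCommGroup N]
  {ρ : E.LPA K →ₙ+* AddMonoid.End M} {σ : E.LPA K →ₙ+* AddMonoid.End N}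

theorem support_eq_of_ann_eq (h : ann ρ = ann σ) : support ρ = support σ := by
  ext v
  rw [mem_support, mem_support, Ne, Ne, ← mem_ann, ← mem_ann, h]

theorem gapVerts_eq_of_ann_eq (h : ann ρ = ann σ) : gapVerts ρ = gapVerts σ := by
  ext v
  refine exists_congr fun F => ?_
  rw [support_eq_of_ann_eq h, Ne, Ne, ← mem_ann, ← mem_ann, h]

theorem ann_eq_of_support_eq (hρ : KerGraded ρ) (hσ : KerGraded σ)
    (hs : support ρ = support σ) (hg : gapVerts ρ = gapVerts σ) : ann ρ = ann σ := by
  ext a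
  rw [mem_ann, mem_ann, map_eq_zero_iff_of_support_eq hρ hσ hs hg]

theorem gapVerts_repN_of_finite {v : V} (hv : ¬ E.IsRegular v)
    (hfin : (E.returnEdges v).Finite) : gapVerts (E.repN K v hv) = {v} := by
  ext u
  rw [mem_gapVerts_repN, Set.mem_singleton_iff, and_iff_left hfin]

theorem gapVerts_repN_of_infinite {v : V} (hv : ¬ E.IsRegular v)
    (hinf : (E.returnEdges v).Infinite) : gapVerts (E.repN K v hv) = ∅ := by
  ext u
  rw [mem_gapVerts_repN]
  exact ⟨fun h => absurd h.2 hinf, fun h => h.elim⟩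

theorem returnEdges_eq_outTo (v : V) : E.returnEdges v = E.outTo (E.root {v}) v := rfl

theorem IsCycleAt.reaches {v : V} {c : List A} (hc : E.IsCycleAt v c) {x y : V}
    (hx : x ∈ E.cycVerts c) (hy : y ∈ E.cycVerts c) : E.Reaches x y := by
  obtain ⟨l, hl, -⟩ := E.exists_segment hc hx hy
  exact ⟨l, hl⟩

theorem IsInfPath.exists_isPath {α : ℕ → A} (hα : E.IsInfPath α) (m n : ℕ) :
    ∃ p, E.IsPath (E.src (α m)) p (E.src (α (m + n))) ∧
      E.pathVerts (E.src (α m)) p ⊆ E.infVerts α := by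
  induction n with
  | zero => exact ⟨[], rfl, by rintro w (rfl | ⟨e, he, -⟩); exacts [⟨m, rfl⟩, by simp at he]⟩
  | succ n ih =>
    obtain ⟨p, hp, hpv⟩ := ih
    refine ⟨p ++ [α (m + n)], E.isPath_append.2 ⟨_, hp, rfl, hα _⟩, ?_⟩
    rintro w (rfl | ⟨e, he, rfl⟩)
    · exact ⟨m, rfl⟩
    · rcases List.mem_append.1 he with he | he
      · exact hpv (Or.inr ⟨e, he, rfl⟩)
      · rw [List.mem_singleton.1 he]
        exact ⟨m + n + 1, (hα _).symm⟩

/-- Take an extreme cycle through the first vertex of α. Extremality leads back to it from every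
vertex of α, so each vertex of the cycle has the whole root as its root. The source of an exit emits
both the exit and a cycle edge into the root. -/
theorem hasType_extremeCycle {α : ℕ → A} (hα : E.IsInfPath α)
    (h : ∀ w ∈ E.infVerts α, ∃ c, w ∈ E.cycVerts c ∧ E.IsExtremeIn c (E.root (E.infVerts α))) :
    ∃ v ∈ E.root (E.infVerts α), E.root (E.infVerts α) ⊆ E.root {v} ∧
      (E.outTo (E.root (E.infVerts α)) v).Nontrivial := by
  obtain ⟨c, hwc, ⟨x, hx⟩, hsub, ⟨e, hec, hne, her⟩, hret⟩ := h (E.src (α 0)) ⟨0, rfl⟩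
  refine ⟨E.src e, hsub hec, ?_, ?_⟩
  · rintro u ⟨_, ⟨n, rfl⟩, hu⟩
    rw [mem_root_singleton]
    obtain ⟨p, hp, hpv⟩ := hα.exists_isPath 0 n
    rw [Nat.zero_add] at hp
    obtain ⟨q, y, hq, -, hy⟩ := hret _ p _ hwc hp fun w hw => mem_root_of_mem (hpv hw)
    exact (hu.trans ⟨q, hq⟩).trans (hx.reaches hy hec)
  · obtain ⟨f, hf, hfe⟩ := id hec
    refine ⟨e, ⟨rfl, her⟩, f, ⟨hfe, hsub (E.rng_mem_cycVerts hx hf)⟩, ?_⟩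
    rintro rfl
    exact hne hf

/-- A vertex with the full root is reached from the cycle and reaches it, so by exclusivity it lies
on the cycle. Edges from there that stay in the root are cycle edges, one at each vertex. -/
theorem hasType_exclusiveCycle {c : List A} (hc : E.IsExclusive c) {v : V}
    (hv : v ∈ E.cycVerts c) :
    (∃ v ∈ E.root (E.cycVerts c), E.root (E.cycVerts c) ⊆ E.root {v}) ∧
      ∀ w ∈ E.root (E.cycVerts c), E.root (E.cycVerts c) ⊆ E.root {w} →
        (E.outTo (E.root (E.cycVerts c)) w).Subsingleton := by
  constructor
  · refine ⟨v, mem_root_of_mem hv, ?_⟩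
    rintro u ⟨x, hx, hu⟩
    obtain ⟨⟨z, hz⟩, -⟩ := hc
    exact mem_root_singleton.2 (hu.trans (hz.reaches hx hv))
  · rintro w ⟨x, hx, l, hl⟩ hw
    obtain ⟨q, hq⟩ := mem_root_singleton.1 (hw (mem_root_of_mem hv))
    have hwc : w ∈ E.cycVerts c := hc.vert_mem hv hq ⟨l, x, hx, hl⟩
    have hmem : ∀ e ∈ E.outTo (E.root (E.cycVerts c)) w, e ∈ c := by
      rintro e ⟨rfl, y, hy, p, hp⟩
      exact hc.mem hwc ⟨p, y, hy, hp⟩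
    exact fun e he f hf => hc.eq_of_src_eq (hmem e he) (hmem f hf) (he.1.trans hf.1.symm)

/-- The type of a graded Chen module is visible in the annihilator. -/
theorem IsGradedChenAnn.hasType {t : ChenType} (h : IsGradedChenAnn (ann ρ) t) :
    E.HasType (support ρ) (gapVerts ρ) t := by
  have hN : ∀ (v : V) (hv : ¬ E.IsRegular v), ann ρ = ann (E.repN K v hv) →
      support ρ = E.root {v} := fun v hv hP => (support_eq_of_ann_eq hP).trans (support_repN hv)
  have hNfin : ∀ (v : V) (hv : ¬ E.IsRegular v), ann ρ = ann (E.repN K v hv) →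
      (E.returnEdges v).Finite → gapVerts ρ = {v} := fun v hv hP hfin =>
    (gapVerts_eq_of_ann_eq hP).trans (gapVerts_repN_of_finite hv hfin)
  cases t with
  | strictlyDecreasing =>
    obtain ⟨α, hα, hroot, hP⟩ := h
    rw [support_eq_of_ann_eq hP, gapVerts_eq_of_ann_eq hP, support_repV hα.1, gapVerts_repV]
    exact ⟨rfl, fun v hv hsub => (hroot v hv).2 hsub⟩
  | relativeSink =>
    rcases h with ⟨v, hv, hP⟩ | ⟨v, hv, hret, hP⟩
    · have hret : E.returnEdges v = ∅ :=
        Set.subset_empty_iff.1 fun e he => (hv : E.out v = ∅) ▸ he.1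
      rw [hN v _ hP, hNfin v _ hP (hret ▸ Set.finite_empty)]
      exact ⟨v, rfl, hret⟩
    · rw [hN v _ hP, hNfin v _ hP (hret ▸ Set.finite_empty)]
      exact ⟨v, rfl, hret⟩
  | extremeCycle =>
    rcases h with ⟨α, hα, -, hext, hP⟩ | ⟨v, hv, hinf, hP⟩ | ⟨v, hv, hfin, hcard, hP⟩
    · rw [support_eq_of_ann_eq hP, gapVerts_eq_of_ann_eq hP, support_repV hα, gapVerts_repV]
      exact Or.inr ⟨rfl, hasType_extremeCycle hα hext⟩
    · rw [hN v _ hP, gapVerts_eq_of_ann_eq hP, gapVerts_repN_of_infinite _ hinf]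
      exact Or.inr ⟨rfl, v, mem_root_of_mem rfl, subset_rfl, hinf.nontrivial⟩
    · rw [hN v _ hP, hNfin v _ hP hfin]
      refine Or.inl ⟨v, rfl, ?_⟩
      obtain ⟨e, f, he, hf, hef⟩ := (Set.one_lt_ncard_iff hfin).1 hcard
      exact ⟨e, he, f, hf, hef⟩
  | exclusiveCycle =>
    rcases h with ⟨c, hc, v, hv, hP⟩ | ⟨v, hv, hcard, hP⟩
    · rw [support_eq_of_ann_eq hP, gapVerts_eq_of_ann_eq hP, support_repC hc hv,
        gapVerts_repC hc hv]
      exact Or.inr ⟨rfl, hasType_exclusiveCycle hc hv⟩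
    · obtain ⟨e, he⟩ := Set.ncard_eq_one.1 hcard
      rw [hN v _ hP, hNfin v _ hP (he ▸ Set.finite_singleton e)]
      exact Or.inl ⟨v, rfl, e, he⟩

end

/-! ### Infinite concatenations of paths -/

/-- The concatenation of the first `n` lists of a sequence. -/
def concat (p : ℕ → List A) : ℕ → List A
  | 0 => []
  | n + 1 => concat p n ++ p n

theorem concat_isPrefix_of_le (p : ℕ → List A) {m n : ℕ} (h : m ≤ n) : concat p m <+: concat p n := by
  induction h with
  | refl => exact List.prefix_rfl
  | step _ ih => exact ih.trans (List.prefix_append _ _)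

theorem le_length_concat {p : ℕ → List A} (hp : ∀ n, p n ≠ []) (n : ℕ) :
    n ≤ (concat p n).length := by
  induction n with
  | zero => exact Nat.zero_le _
  | succ n ih =>
    rw [concat, List.length_append]
    have := List.length_pos_iff.2 (hp n)
    omega

theorem mem_of_mem_concat {p : ℕ → List A} {n : ℕ} {e : A} (h : e ∈ concat p n) :
    ∃ i, e ∈ p i := by
  induction n with
  | zero => simp [concat] at h
  | succ n ih =>
    rcases List.mem_append.1 h with h | h
    exacts [ih h, ⟨n, h⟩]

theorem isPath_concat {w : ℕ → V} {p : ℕ → List A} (hp : ∀ n, E.IsPath (w n) (p n) (w (n + 1)))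
    (n : ℕ) : E.IsPath (w 0) (concat p n) (w n) := by
  induction n with
  | zero => rfl
  | succ n ih => exact E.isPath_append.2 ⟨w n, ih, hp n⟩

theorem IsPath.rng_eq_src {u v : V} {l : List A} (h : E.IsPath u l v) {k : ℕ} {e f : A}
    (he : l[k]? = some e) (hf : l[k + 1]? = some f) : E.rng e = E.src f := by
  induction l generalizing u k with
  | nil => simp at he
  | cons g l ih =>
    cases k with
    | zero =>
      cases l with
      | nil => simp at hf
      | cons g' l =>
        simp only [List.getElem?_cons_zero, List.getElem?_cons_succ, Option.some.injEq] at he hf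
        rw [← he, ← hf]
        exact h.2.1.symm
    | succ k => exact ih h.2 (by simpa using he) (by simpa using hf)

/-- The infinite path `p₀p₁p₂…`. -/
theorem exists_infPath_concat {w : ℕ → V} {p : ℕ → List A}
    (hp : ∀ n, E.IsPath (w n) (p n) (w (n + 1))) (hne : ∀ n, p n ≠ []) :
    ∃ α : ℕ → A, E.IsInfPath α ∧ (∀ k, ∃ n, α k ∈ p n) ∧
      (∀ n, E.src (α (concat p n).length) = w n) ∧
      ∀ n e l, p n = e :: l → α (concat p n).length = e := by
  -- All pieces are nonempty, so k + 1 of them have more than k edges.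
  have hex : ∀ k, ∃ a, (concat p (k + 1))[k]? = some a := fun k =>
    ⟨_, List.getElem?_eq_getElem (le_length_concat hne (k + 1))⟩
  choose α hα using hex
  have hval : ∀ n k, k + 1 ≤ n → (concat p n)[k]? = some (α k) := by
    intro n k h
    obtain ⟨t, ht⟩ := concat_isPrefix_of_le p h
    rw [← ht, List.getElem?_append_left (le_length_concat hne (k + 1)), hα]
  have hhead : ∀ n e l, p n = e :: l → α (concat p n).length = e := by
    intro n e l h
    have h₁ := hval ((concat p n).length + 1) _ le_rfl
    obtain ⟨t, ht⟩ := concat_isPrefix_of_le p (Nat.succ_le_succ (le_length_concat hne n))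
    rw [← ht, concat, h] at h₁
    simpa using h₁.symm
  refine ⟨α, fun k => ?_, fun k => mem_of_mem_concat (List.mem_of_getElem? (hα k)),
    fun n => ?_, hhead⟩
  · exact (isPath_concat hp (k + 2)).rng_eq_src (hval _ _ (by omega)) (hval _ _ le_rfl)
  · obtain ⟨e, l, h⟩ := List.exists_cons_of_ne_nil (hne n)
    have := hp n
    rw [h] at this
    rw [hhead n e l h, this.1]

theorem strictMono_length_concat {p : ℕ → List A} (hp : ∀ n, p n ≠ []) :
    StrictMono fun n => (concat p n).length :=
  strictMono_nat_of_lt_succ fun n => by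
    have := List.length_pos_iff.2 (hp n)
    simp only [concat, List.length_append]
    omega

/-! ### Eventually periodic sequences -/

theorem IsRational.eventuallyPeriodic {α : ℕ → A} (h : E.IsRational α) :
    EventuallyPeriodic α := by
  obtain ⟨v, c, hc, -, m, n, hk⟩ := h
  refine ⟨m, c.length, List.length_pos_iff.2 hc, fun j => ?_⟩
  rw [Nat.add_assoc, hk, hk]
  have hmod : (n + (c.length + j)) % c.length = (n + j) % c.length := by
    rw [Nat.add_left_comm, Nat.add_mod_left]
  simp only [hmod]

/-- A periodic tail returns to each of its vertices, which strict descent forbids. -/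
theorem IsStrictlyDecreasing.not_eventuallyPeriodic {α : ℕ → A}
    (h : E.IsStrictlyDecreasing α) : ¬ EventuallyPeriodic α := by
  obtain ⟨hα, t, -, ht, hdec⟩ := h
  rintro ⟨a, L, hL, hper⟩
  have hmul : ∀ j, α (t a + L * j) = α (t a) := by
    intro j
    induction j with
    | zero => rfl
    | succ j ih =>
      have hle : a ≤ t a := ht.id_le a
      have := hper (t a - a + L * j)
      rw [show a + L + (t a - a + L * j) = t a + L * (j + 1) by rw [Nat.mul_succ]; omega,
        show a + (t a - a + L * j) = t a + L * j by omega] at this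
      rw [this, ih]
  apply (hdec a).2
  -- After `t (a + 1)` full periods the path is at the edge with index `t a` again, and the index
  -- has passed `t (a + 1)`. Since a ≤ `t a`, everything happens in the periodic part.
  have hle : t (a + 1) ≤ t a + L * t (a + 1) :=
    (Nat.le_mul_of_pos_left _ hL).trans (Nat.le_add_left _ _)
  obtain ⟨d, hd⟩ := Nat.exists_eq_add_of_le hle
  have := hα.reaches (t (a + 1)) d
  rwa [← hd, hmul] at this

/-- Preperiod, period and finitely many initial entries determine the sequence, and these entries
come from a finite set. -/
theorem countable_eventuallyPeriodic {S : Set A} (hS : S.Finite) :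
    {α : ℕ → A | EventuallyPeriodic α ∧ ∀ k, α k ∈ S}.Countable := by
  have hsub : {α : ℕ → A | EventuallyPeriodic α ∧ ∀ k, α k ∈ S} ⊆
      ⋃ x : ℕ × ℕ, {α | 0 < x.2 ∧ (∀ j, α (x.1 + x.2 + j) = α (x.1 + j)) ∧ ∀ k, α k ∈ S} := by
    rintro α ⟨⟨a, L, hL, hper⟩, hα⟩
    exact Set.mem_iUnion.2 ⟨(a, L), hL, hper, hα⟩
  refine (Set.countable_iUnion fun x => ?_).mono hsub
  obtain ⟨a, L⟩ := x
  have := hS.to_subtype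
  have hinj : Function.Injective
      (fun (α : {α : ℕ → A | 0 < L ∧ (∀ j, α (a + L + j) = α (a + j)) ∧ ∀ k, α k ∈ S})
        (i : Fin (a + L)) => (⟨α.1 i, α.2.2.2 i⟩ : S)) := by
    rintro ⟨α, hL, hα, _⟩ ⟨β, _, hβ, _⟩ h
    refine Subtype.ext (funext fun k => ?_)
    induction k using Nat.strong_induction_on with
    | _ k ih =>
      by_cases hk : k < a + L
      · exact congrArg Subtype.val (congrFun h ⟨k, hk⟩)
      · obtain ⟨j, rfl⟩ := Nat.exists_eq_add_of_le (not_lt.1 hk)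
        exact (hα j).trans ((ih (a + j) (by omega)).trans (hβ j).symm)
  have := Finite.of_injective _ hinj
  exact (Set.toFinite _).countable

/-- If two closed paths at `w` start with different edges, then some infinite concatenation of
these paths is not eventually periodic. -/
theorem exists_not_eventuallyPeriodic {w : V} {e f : A} (hef : e ≠ f) {l m : List A}
    (hl : E.IsPath w (e :: l) w) (hm : E.IsPath w (f :: m) w) :
    ∃ α, E.IsInfPath α ∧ ¬ EventuallyPeriodic α ∧
      ∀ k, E.Reaches w (E.src (α k)) ∧ E.Reaches (E.src (α k)) w := by
  classical
  -- A subset of ℕ encodes which of the two closed paths is used at each stage. There are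
  -- uncountably many subsets but only countably many eventually periodic sequences with edges in
  -- the two paths.
  let p : Set ℕ → ℕ → List A := fun g n => if n ∈ g then e :: l else f :: m
  have hp : ∀ g n, E.IsPath w (p g n) w := fun g n => by
    by_cases h : n ∈ g
    · simpa [p, h] using hl
    · simpa [p, h] using hm
  have hne : ∀ g n, p g n ≠ [] := fun g n => by
    by_cases h : n ∈ g <;> simp [p, h]
  choose α hα hmem hsrc hhead using fun g : Set ℕ =>
    exists_infPath_concat (w := fun _ => w) (hp g) (hne g)
  have hinj : Function.Injective α := by
    intro g g' h
    -- Once the first n pieces agree, the next edge is e or f and reveals which piece comes next.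
    have hmem_iff : ∀ n, concat (p g) n = concat (p g') n → (n ∈ g ↔ n ∈ g') := by
      intro n hn
      by_cases h₁ : n ∈ g <;> by_cases h₂ : n ∈ g' <;> simp only [h₁, h₂]
      · have a₁ := hhead g n e l (by simp [p, h₁])
        have a₂ := hhead g' n f m (by simp [p, h₂])
        rw [h, hn, a₂] at a₁
        exact absurd a₁.symm hef
      · have a₁ := hhead g n f m (by simp [p, h₁])
        have a₂ := hhead g' n e l (by simp [p, h₂])
        rw [h, hn, a₂] at a₁
        exact absurd a₁ hef
    have hcat : ∀ n, concat (p g) n = concat (p g') n := by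
      intro n
      induction n with
      | zero => rfl
      | succ n ih => simp only [concat, ih, p, hmem_iff n ih]
    exact Set.ext fun n => hmem_iff n (hcat n)
  obtain ⟨g, hg⟩ : ∃ g, ¬ EventuallyPeriodic (α g) := by
    by_contra! hcon
    have hfin : {x | x ∈ e :: l ∨ x ∈ f :: m}.Finite :=
      (List.finite_toSet (e :: l)).union (List.finite_toSet (f :: m))
    have hcount := (countable_eventuallyPeriodic hfin).preimage hinj
    have huniv : α ⁻¹' {β | EventuallyPeriodic β ∧ ∀ k, β k ∈ {x | x ∈ e :: l ∨ x ∈ f :: m}} =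
        Set.univ := by
      refine Set.eq_univ_of_forall fun g => ⟨hcon g, fun k => ?_⟩
      obtain ⟨n, hn⟩ := hmem g k
      by_cases h : n ∈ g
      · exact Or.inl (by simpa [p, h] using hn)
      · exact Or.inr (by simpa [p, h] using hn)
    rw [huniv, Set.countable_univ_iff] at hcount
    obtain ⟨F, hF⟩ := exists_surjective_nat (Set ℕ)
    exact Function.cantor_surjective F hF
  refine ⟨α g, hα g, hg, fun k => ⟨?_, ?_⟩⟩
  · have := (hα g).reaches 0 k
    rw [Nat.zero_add] at this
    rwa [show E.src (α g 0) = w from hsrc g 0] at this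
  · obtain ⟨d, hd⟩ := Nat.exists_eq_add_of_le (le_length_concat (hne g) k)
    have := (hα g).reaches k d
    rwa [← hd, hsrc g k] at this

/-! ### Cycles -/

/-- Close e with a return path without repetitions that meets s(e) only at its end. -/
theorem exists_cycle_of_reaches {e : A} (h : E.Reaches (E.rng e) (E.src e)) :
    ∃ l, E.IsCycleAt (E.src e) (e :: l) := by
  obtain ⟨p, hp⟩ := h
  obtain ⟨l, w, rfl, hl, hnd, hmem⟩ :=
    E.exists_simple (S := {E.src e}) ⟨p, E.src e, rfl, hp⟩
  refine ⟨l, by simp, ⟨rfl, hl⟩, ?_⟩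
  rw [List.map_cons, List.nodup_cons]
  refine ⟨?_, hnd⟩
  rw [List.mem_map]
  rintro ⟨f, hf, hfe⟩
  exact hmem f hf hfe

theorem IsCycleAt.exists_rotated {v w : V} {c : List A} (hc : E.IsCycleAt v c)
    (hw : w ∈ E.cycVerts c) : ∃ d, d ~r c ∧ E.IsCycleAt w d := by
  obtain ⟨-, hp, hnd⟩ := hc
  obtain ⟨g, hg, rfl⟩ := hw
  obtain ⟨a, b, rfl⟩ := List.append_of_mem hg
  obtain ⟨z, h₁, h₂⟩ := E.isPath_append.1 hp
  obtain rfl : E.src g = z := h₂.1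
  refine ⟨(g :: b) ++ a, List.isRotated_append, by simp, E.isPath_append.2 ⟨v, h₂, h₁⟩, ?_⟩
  exact ((List.perm_append_comm).map _).nodup_iff.1 hnd

/-- With no choice of edge at any common source, two paths from u follow the same edges until one of
them stops. -/
theorem IsPath.isPrefix_or_isPrefix {u x y : V} {p q : List A} (hp : E.IsPath u p x)
    (hq : E.IsPath u q y) (h : ∀ e ∈ p, ∀ f ∈ q, E.src e = E.src f → e = f) :
    p <+: q ∨ q <+: p := by
  induction p generalizing u q with
  | nil => exact Or.inl ⟨q, rfl⟩
  | cons e p ih =>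
    cases q with
    | nil => exact Or.inr ⟨e :: p, rfl⟩
    | cons f q =>
      obtain rfl := h e (by simp) f (by simp) (hp.1.trans hq.1.symm)
      rcases ih hp.2 hq.2 (fun e he f hf => h e (by simp [he]) f (by simp [hf])) with h | h
      · exact Or.inl ((List.prefix_cons_inj e).2 h)
      · exact Or.inr ((List.prefix_cons_inj e).2 h)

theorem IsPath.end_unique {u x y : V} {p : List A} (hp : E.IsPath u p x)
    (hq : E.IsPath u p y) : x = y := by
  induction p generalizing u with
  | nil => exact (show u = x from hp).symm.trans hq
  | cons e p ih => exact ih hp.2 hq.2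

/-- If d went on after c, it would leave its base a second time. -/
theorem IsCycleAt.eq_of_isPrefix {w : V} {c d : List A} (hc : E.IsCycleAt w c)
    (hd : E.IsCycleAt w d) (h : c <+: d) : c = d := by
  obtain ⟨r, rfl⟩ := h
  obtain ⟨x, h₁, h₂⟩ := E.isPath_append.1 hd.2.1
  obtain rfl := hc.2.1.end_unique h₁
  cases r with
  | nil => simp
  | cons f r =>
    cases c with
    | nil => exact absurd rfl hc.1
    | cons g c =>
      have := hd.2.2
      rw [List.cons_append, List.map_cons, List.nodup_cons] at this
      refine absurd (List.mem_map.2 ⟨f, by simp, ?_⟩) this.1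
      rw [hc.2.1.1]
      exact h₂.1

/-- An edge from v into W closes up to a cycle, all of whose vertices have root W and hence emit at
most one edge into W. Another cycle meeting it stays in W too, so it has no choice but to follow the
same edges. -/
theorem exists_isExclusive {W : Set V} (hroot : ∀ u v, E.Reaches u v → v ∈ W → u ∈ W) {v : V}
    (hv : v ∈ W) (hW : W ⊆ E.root {v}) (hout : (E.outTo W v).Nonempty)
    (huniq : ∀ w ∈ W, W ⊆ E.root {w} → (E.outTo W w).Subsingleton) :
    ∃ c, E.IsExclusive c ∧ v ∈ E.cycVerts c := by
  obtain ⟨e, rfl, he⟩ := hout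
  obtain ⟨l, hl⟩ := exists_cycle_of_reaches (mem_root_singleton.1 (hW he))
  have hec : E.src e ∈ E.cycVerts (e :: l) := ⟨e, by simp, rfl⟩
  refine ⟨e :: l, ⟨⟨_, hl⟩, fun w hw d hd => ?_⟩, hec⟩
  have hcW : ∀ x ∈ E.cycVerts (e :: l), x ∈ W := fun x hx => hroot _ _ (hl.reaches hx hec) hv
  have hdet : ∀ g ∈ e :: l, ∀ f ∈ d, E.src g = E.src f → g = f := by
    intro g hg f hf hgf
    have hgc : E.src g ∈ E.cycVerts (e :: l) := ⟨g, hg, rfl⟩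
    have hwd : w ∈ E.cycVerts d := by
      obtain ⟨f, d', rfl⟩ := List.exists_cons_of_ne_nil hd.1
      exact ⟨f, by simp, hd.2.1.1⟩
    refine huniq (E.src g) (hcW _ hgc) (fun u hu => ?_) ⟨rfl, hcW _ (E.rng_mem_cycVerts hl hg)⟩
      ⟨hgf.symm, hroot _ _ (hd.reaches (E.rng_mem_cycVerts hd hf) hwd) (hcW w hw)⟩
    exact mem_root_singleton.2 ((mem_root_singleton.1 (hW hu)).trans (hl.reaches hec hgc))
  obtain ⟨c, hrot, hc⟩ := hl.exists_rotated hw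
  have hdet' : ∀ g ∈ c, ∀ f ∈ d, E.src g = E.src f → g = f := fun g hg =>
    hdet g (hrot.mem_iff.1 hg)
  rcases hc.2.1.isPrefix_or_isPrefix hd.2.1 hdet' with h | h
  · exact hc.eq_of_isPrefix hd h ▸ hrot
  · exact hd.eq_of_isPrefix hc h ▸ hrot

theorem pathVerts_subset {W : Set V} (hroot : ∀ u v, E.Reaches u v → v ∈ W → u ∈ W) {u v : V}
    {p : List A} (hp : E.IsPath u p v) (hv : v ∈ W) : E.pathVerts u p ⊆ W := by
  induction p generalizing u with
  | nil =>
    rintro w (rfl | ⟨e, he, -⟩)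
    · exact (show w = v from hp) ▸ hv
    · simp at he
  | cons e p ih =>
    rintro w (rfl | ⟨f, hf, rfl⟩)
    · exact hroot _ _ ⟨_, hp⟩ hv
    · rcases List.mem_cons.1 hf with rfl | hf
      · exact hroot _ _ ⟨p, hp.2⟩ hv
      · exact ih hp.2 (Or.inr ⟨f, hf, rfl⟩)

/-- An edge from u into W closes up to a cycle because W = R(u). The same equality gives the return
paths, and the branching vertex w, reached from u, forces an exit. -/
theorem exists_isExtremeIn {W : Set V} (hroot : ∀ u v, E.Reaches u v → v ∈ W → u ∈ W) {u w : V}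
    (hu : u ∈ W) (hWu : W ⊆ E.root {u}) (hout : (E.outTo W u).Nonempty) (hw : w ∈ W)
    (huw : E.Reaches u w) (hnt : (E.outTo W w).Nontrivial) :
    ∃ c, u ∈ E.cycVerts c ∧ E.IsExtremeIn c W := by
  obtain ⟨g, rfl, hg⟩ := hout
  obtain ⟨l, hl⟩ := exists_cycle_of_reaches (mem_root_singleton.1 (hWu hg))
  have hgc : E.src g ∈ E.cycVerts (g :: l) := ⟨g, by simp, rfl⟩
  refine ⟨g :: l, hgc, ⟨_, hl⟩, fun x hx => hroot _ _ (hl.reaches hx hgc) hu, ?_, ?_⟩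
  -- Without an exit the path from u to w stays on the cycle, so both edges of w into W would be
  -- cycle edges with the same source.
  · by_contra! hcon
    have hmem : ∀ e, E.src e ∈ E.cycVerts (g :: l) → E.rng e ∈ W → e ∈ g :: l :=
      fun e he hr => by
        by_contra hne
        exact hcon e he hne hr
    have hpath : ∀ (p : List A) (x : V), E.IsPath x p w → x ∈ E.cycVerts (g :: l) →
        w ∈ E.cycVerts (g :: l) := by
      intro p
      induction p with
      | nil =>
        intro x hp hx
        exact (show x = w from hp) ▸ hx
      | cons e p ih =>
        intro x hp hx
        have he := hmem e (hp.1.symm ▸ hx) (hroot _ _ ⟨p, hp.2⟩ hw)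
        exact ih _ hp.2 (E.rng_mem_cycVerts hl he)
    obtain ⟨p, hp⟩ := huw
    have hwc := hpath p _ hp hgc
    obtain ⟨e, he, f, hf, hef⟩ := hnt
    exact hef (List.inj_on_of_nodup_map hl.2.2 (hmem e (he.1.symm ▸ hwc) he.2)
      (hmem f (hf.1.symm ▸ hwc) hf.2) (he.1.trans hf.1.symm))
  · intro x p y _ hp hpv
    have hy : y ∈ W := by
      rcases List.eq_nil_or_concat p with rfl | ⟨p', e, rfl⟩
      · exact (show x = y from hp) ▸ hpv (Or.inl rfl)
      · obtain ⟨z, -, hz⟩ := E.isPath_append.1 (List.concat_eq_append ▸ hp)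
        exact hpv (Or.inr ⟨e, by simp, hz.2⟩)
    obtain ⟨q, hq⟩ := mem_root_singleton.1 (hWu hy)
    exact ⟨q, _, hq, pathVerts_subset hroot hq hu, hgc⟩

/-- A set of vertices which is the root of a sequence, directed, and not the root of any of its
elements is the root of a strictly decreasing infinite path. -/
theorem exists_isStrictlyDecreasing {W : Set V}
    (hroot : ∀ u v, E.Reaches u v → v ∈ W → u ∈ W)
    (hdir : ∀ u ∈ W, ∀ v ∈ W, ∃ w ∈ W, E.Reaches u w ∧ E.Reaches v w)
    (x : ℕ → V) (hx : ∀ n, x n ∈ W) (hcof : ∀ u ∈ W, ∃ n, E.Reaches u (x n))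
    (hW : ∀ v ∈ W, ¬ W ⊆ E.root {v}) :
    ∃ α, E.IsStrictlyDecreasing α ∧ E.root (E.infVerts α) = W := by
  -- Pick y in W that does not reach w, and let w' be reached by w, y and `x n`. If w' reached w,
  -- then so would y. Being reached by `x n` makes the sequence cofinal in W.
  have step : ∀ (n : ℕ) (w : W), ∃ w' : W, E.Reaches w w' ∧ E.Reaches (x n) w' ∧
      ¬ E.Reaches w' w := by
    rintro n ⟨w, hw⟩
    obtain ⟨y, hy, hyw⟩ := Set.not_subset.1 (hW w hw)
    obtain ⟨z, hz, h₁, h₂⟩ := hdir w hw y hy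
    obtain ⟨w', hw', h₃, h₄⟩ := hdir z hz (x n) (hx n)
    exact ⟨⟨w', hw'⟩, h₁.trans h₃, h₄, fun h => hyw (mem_root_singleton.2
      ((h₂.trans h₃).trans h))⟩
  choose next hnext₁ hnext₂ hnext₃ using step
  let w : ℕ → W := fun n => Nat.rec (motive := fun _ => W) ⟨x 0, hx 0⟩ next n
  have hw : ∀ n, w (n + 1) = next n (w n) := fun n => rfl
  have hstep : ∀ n : ℕ, E.Reaches (w n).1 (w (n + 1)).1 := fun n => by
    rw [hw]
    exact hnext₁ n (w n)
  choose p hp using hstep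
  have hne : ∀ n, p n ≠ [] := by
    intro n h
    have := hp n
    rw [h] at this
    have hwn : (w n).1 = (w (n + 1)).1 := this
    refine hnext₃ n (w n) ?_
    rw [← hw, ← hwn]
    exact Reaches.refl _
  obtain ⟨α, hα, -, hsrc, -⟩ := exists_infPath_concat (w := fun n => (w n).1) hp hne
  refine ⟨α, ⟨hα, fun n => (concat p n).length, rfl, strictMono_length_concat hne, fun k => ?_⟩,
    ?_⟩
  · simp only [hsrc]
    exact ⟨hnext₁ k (w k), hnext₃ k (w k)⟩
  · ext u
    constructor
    · rintro ⟨_, ⟨k, rfl⟩, hu⟩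
      refine hroot _ _ (hu.trans ?_) (w k).2
      obtain ⟨d, hd⟩ := Nat.exists_eq_add_of_le (le_length_concat hne k)
      have := hα.reaches k d
      rwa [← hd, hsrc k] at this
    · intro hu
      obtain ⟨n, hn⟩ := hcof u hu
      exact ⟨w (n + 1), ⟨_, hsrc (n + 1)⟩, hn.trans (hnext₂ n (w n))⟩

/-! ### Existence of a graded Chen module with the given annihilator -/

section

variable {M : Type*} [AddCommGroup M] {ρ : E.LPA K →ₙ+* AddMonoid.End M} {ℳ : ℤ → AddSubgroup M}
  [DirectSum.Decomposition ℳ]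

/-- The gap vertex v forces W = R(v) and D = {v}, which is the pair of N_v since v has finitely many
return edges. Their number then selects the type. -/
theorem IsGradedSimple.exists_type_of_gapVert (hM : IsGradedSimple ρ ℳ) {v : V}
    (hv : v ∈ gapVerts ρ) : ∃ t, IsGradedChenAnn (ann ρ) t := by
  have hs : support ρ = E.root {v} := by
    ext u
    rw [mem_root_singleton]
    exact ⟨fun hu => hM.reaches_gapVert hu hv,
      fun hu => mem_support_of_reaches hu (gapVerts_subset_support hv)⟩
  have hfin : (E.returnEdges v).Finite := by
    obtain ⟨F, hF, -⟩ := id hv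
    rw [returnEdges_eq_outTo, ← hs, ← hF]
    exact F.finite_toSet
  have hreg := not_isRegular_of_mem_gapVerts hv
  have hann : ann ρ = ann (E.repN K v hreg) :=
    ann_eq_of_support_eq hM.kerGraded (kerGraded_repN hreg) (hs.trans (support_repN hreg).symm)
      ((hM.gapVerts_subsingleton.eq_singleton_of_mem hv).trans
        (gapVerts_repN_of_finite hreg hfin).symm)
  by_cases hsink : E.IsSink v
  · exact ⟨.relativeSink, Or.inl ⟨v, hsink, hann⟩⟩
  have hinf : E.IsInfiniteEmitter v := by
    by_contra h
    exact hreg ⟨hsink, h⟩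
  rcases Nat.lt_trichotomy (E.returnEdges v).ncard 1 with h | h | h
  · exact ⟨.relativeSink, Or.inr ⟨v, hinf, (Set.ncard_eq_zero hfin).1 (by omega), hann⟩⟩
  · exact ⟨.exclusiveCycle, Or.inr ⟨v, hinf, h, hann⟩⟩
  · exact ⟨.extremeCycle, Or.inr (Or.inr ⟨v, hinf, hfin, h, hann⟩)⟩

/-- No vertex of W is a dead end in W. The case distinction is whether W is the root of one of its
vertices and, if so, whether some vertex with root W branches inside W. -/
theorem IsGradedSimple.exists_type_of_gapVerts_eq_empty (hM : IsGradedSimple ρ ℳ)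
    (hg : gapVerts ρ = ∅) : ∃ t, IsGradedChenAnn (ann ρ) t := by
  have hroot : ∀ u v, E.Reaches u v → v ∈ support ρ → u ∈ support ρ :=
    fun u v h hv => mem_support_of_reaches h hv
  have hout : ∀ v ∈ support ρ, (E.outTo (support ρ) v).Nonempty := fun v hv =>
    outTo_nonempty hv (hg ▸ Set.notMem_empty v)
  have hannV : ∀ α, E.IsInfPath α → ¬ EventuallyPeriodic α →
      E.root (E.infVerts α) = support ρ → ann ρ = ann (E.repV K α) := fun α hα hper hα' =>
    ann_eq_of_support_eq hM.kerGraded (kerGraded_repV hper) (hα'.symm.trans (support_repV hα).symm)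
      (hg.trans (gapVerts_repV α).symm)
  by_cases hmin : ∃ v ∈ support ρ, support ρ ⊆ E.root {v}
  · obtain ⟨v, hv, hW⟩ := hmin
    by_cases huniq : ∀ w ∈ support ρ, support ρ ⊆ E.root {w} →
        (E.outTo (support ρ) w).Subsingleton
    · obtain ⟨c, hc, hvc⟩ := exists_isExclusive hroot hv hW (hout v hv) huniq
      refine ⟨.exclusiveCycle, Or.inl ⟨c, hc, v, hvc, ?_⟩⟩
      refine ann_eq_of_support_eq hM.kerGraded (kerGraded_repC hc hvc) ?_
        (hg.trans (gapVerts_repC hc hvc).symm)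
      rw [support_repC hc hvc]
      refine Set.Subset.antisymm (fun u hu => ?_) ?_
      · exact ⟨v, hvc, mem_root_singleton.1 (hW hu)⟩
      · rintro u ⟨x, hx, hu⟩
        obtain ⟨⟨z, hz⟩, -⟩ := hc
        exact hroot _ _ (hu.trans (hz.reaches hx hvc)) hv
    · push Not at huniq
      obtain ⟨w, hw, hWw, hnt⟩ := huniq
      obtain ⟨e, he, f, hf, hef⟩ := id hnt
      obtain ⟨l, hl⟩ := mem_root_singleton.1 (hWw he.2)
      obtain ⟨m, hm⟩ := mem_root_singleton.1 (hWw hf.2)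
      obtain ⟨α, hα, hper, hreach⟩ := exists_not_eventuallyPeriodic hef
        (l := l) (m := m) ⟨he.1, hl⟩ ⟨hf.1, hm⟩
      have hαW : E.root (E.infVerts α) = support ρ := by
        refine Set.Subset.antisymm ?_ fun u hu => ?_
        · rintro u ⟨_, ⟨k, rfl⟩, hu⟩
          exact hroot _ _ (hu.trans (hreach k).2) hw
        · exact ⟨_, ⟨0, rfl⟩, (mem_root_singleton.1 (hWw hu)).trans (hreach 0).1⟩
      refine ⟨.extremeCycle, Or.inl ⟨α, hα, fun h => hper h.eventuallyPeriodic, ?_,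
        hannV α hα hper hαW⟩⟩
      rintro _ ⟨k, rfl⟩
      have hk : E.src (α k) ∈ support ρ := hroot _ _ (hreach k).2 hw
      rw [hαW]
      exact exists_isExtremeIn hroot hk
        (fun u hu => mem_root_singleton.2 ((mem_root_singleton.1 (hWw hu)).trans (hreach k).1))
        (hout _ hk) hw (hreach k).2 hnt
  · push Not at hmin
    obtain ⟨v, hv⟩ := hM.support_nonempty
    -- Directedness comes from the countable set attached to v: its elements are reached by v, and u
    -- reaches one of them.
    have hdir : ∀ u ∈ support ρ, ∀ v ∈ support ρ, ∃ w ∈ support ρ, E.Reaches u w ∧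
        E.Reaches v w := by
      intro u hu v hv
      obtain ⟨C, -, hC, hcof⟩ := hM.exists_countable hv
      obtain ⟨w, hw, huw⟩ := hcof u hu
      exact ⟨w, (hC w hw).2, huw, (hC w hw).1⟩
    obtain ⟨C, hCc, hC, hcof⟩ := hM.exists_countable hv
    obtain ⟨w, hw, -⟩ := hcof v hv
    obtain ⟨x, rfl⟩ := hCc.exists_eq_range ⟨w, hw⟩
    obtain ⟨α, hα, hαW⟩ := exists_isStrictlyDecreasing hroot hdir x (fun n => (hC _ ⟨n, rfl⟩).2)
      (fun u hu => by
        obtain ⟨_, ⟨n, rfl⟩, h⟩ := hcof u hu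
        exact ⟨n, h⟩) hmin
    refine ⟨.strictlyDecreasing, α, hα, fun u hu => ?_,
      hannV α hα.1 hα.not_eventuallyPeriodic hαW⟩
    rw [hαW] at hu ⊢
    exact ⟨fun y hy => hroot _ _ (mem_root_singleton.1 hy) hu, hmin u hu⟩

end

end DirGraph

/-! ### The classification theorem -/

theorem mainTheorem1 {K V A M : Type*} [Field K] (E : DirGraph V A) [AddCommGroup M]
    (ρ : E.LPA K →ₙ+* AddMonoid.End M) (ℳ : ℤ → AddSubgroup M) [DirectSum.Decomposition ℳ]
    (hM : DirGraph.IsGradedSimple ρ ℳ) :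
    ∃! t : DirGraph.ChenType, DirGraph.IsGradedChenAnn (DirGraph.ann ρ) t := by
  have hex : ∃ t, DirGraph.IsGradedChenAnn (DirGraph.ann ρ) t := by
    rcases (DirGraph.gapVerts ρ).eq_empty_or_nonempty with h | ⟨v, hv⟩
    · exact hM.exists_type_of_gapVerts_eq_empty h
    · exact hM.exists_type_of_gapVert hv
  obtain ⟨t, ht⟩ := hex
  -- Both types impose their conditions on the same pair (W, D), so they coincide.
  exact ⟨t, ht, fun s hs => hs.hasType.eq hM.gapVerts_subsingleton ht.hasType⟩
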